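/- **Programs.** Let $\mathsf{TID}$ be a finite totally ordered set of thread IDs (e.g. a finite set of positive integers). A multithreaded program $P$ consists of a set $\mathsf{Lock}$, a set $\mathsf{Shared}$ of shared states and, for each $i\in\mathsf{TID}$, a set $\mathsf{Local}_i$ that is the disjoint union of sets $\mathsf{Acquire}_i,\mathsf{Release}_i,\mathsf{Barrier}_i,\mathsf{Nsync}_i,\mathsf{Term}_i$, and a set $\mathsf{Stmt}_i$ consisting of statements $\mathsf{acquire}_i(l)$, $\mathsf{release}_i(l)$ ($l\in\mathsf{Lock}$), $\mathsf{exit}_i$, and further "nsync" statements. Each acquire, release or barrier state $\sigma$ has a successor $\mathsf{next}(\sigma)\in\mathsf{Local}_i$; each acquire or release state has a lock $\mathsf{lock}(\sigma)$; each nsync state has a nonempty set $\mathsf{stmts}(\sigma)$ of nsync statements of thread $i$ and a map $\mathsf{update}(\sigma):\mathsf{stmts}(\sigma)\times\mathsf{Shared}\to\mathsf{Local}_i\times\mathsf{Shared}$. The $\mathsf{Stmt}_i$ are pairwise disjoint, $\mathsf{Stmt}=\bigcup_i\mathsf{Stmt}_i$, and $\mathsf{tid}(t)=i$ for $t\in\mathsf{Stmt}_i$.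 A state $s=\langle\xi,\zeta,\theta,w\rangle$ consists of local states $\xi_i\in\mathsf{Local}_i$, $\zeta\in\mathsf{Shared}$, an owner $\theta(l)$ of each lock $l$ (a thread or "free"), and a set $w\subseteq\mathsf{TID}$ of blocked threads. Enabled in thread $i$ are: $\mathsf{acquire}_i(l)$ if $\xi_i\in\mathsf{Acquire}_i$ and $l=\mathsf{lock}(\xi_i)$ is free; $\mathsf{release}_i(l)$ if $\xi_i\in\mathsf{Release}_i$ and $l=\mathsf{lock}(\xi_i)$ is owned by $i$; $\mathsf{exit}_i$ if $\xi_i\in\mathsf{Barrier}_i$ and $i\notin w$; all of $\mathsf{stmts}(\xi_i)$ if $\xi_i\in\mathsf{Nsync}_i$; nothing otherwise. $\mathsf{enabled}(s)$ is the union over all threads. Executing an enabled statement $t$ of thread $i$ moves thread $i$ to $\sigma'=\mathsf{next}(\xi_i)$, making $i$ the owner of $l$ (acquire) or $l$ free (release), or, if $t$ is nsync, changes $(\xi_i,\zeta)$ to $(\sigma',\zeta')=\mathsf{update}(\xi_i)(t,\zeta)$. Moreover, if $\sigma'\in\mathsf{Barrier}_i$ then $w$ becomes $w\cup\{i\}$,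 or $\emptyset$ if $w\cup\{i\}=\mathsf{TID}$. The rest of the state is unchanged; the result is $\mathsf{execute}(s,t)$. An execution is a finite or infinite chain of transitions $s_0\xrightarrow{t_1}s_1\xrightarrow{t_2}\cdots$ with $t_k\in\mathsf{enabled}(s_{k-1})$ and $s_k=\mathsf{execute}(s_{k-1},t_k)$. **Data races.** Fix a conflict relation: a symmetric relation on $\mathsf{Stmt}$ that relates only nsync statements of different threads, and such that two unrelated nsync statements $t_1,t_2$ of different threads satisfy $\mathsf{execute}(\mathsf{execute}(s,t_1),t_2)=\mathsf{execute}(\mathsf{execute}(s,t_2),t_1)$ for all states $s$ at which both are enabled. The events of an execution are the pairs $e_k=\langle t_k,n_k\rangle$, where $n_k$ is the number of $j\in[1,k]$ with $\mathsf{tid}(t_j)=\mathsf{tid}(t_k)$. Happens-before is the transitive closure of the union of three relations: (i) the order of events within one thread; (ii) $(e_i,e_j)$ with $i<j$, where for some lock $l$, $t_i$ is a release on $l$, $t_j$ is an acquire on $l$, and no $t_k$ with $i<k<j$ is an acquire on $l$; (iii) $(e,e')$ with $\mathsf{epoch}(e)<\mathsf{epoch}(e')$, where $\mathsf{epoch}(e)$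 is the number of $\mathsf{exit}$ events in the thread of $e$ preceding or including $e$. The execution has a data race if it has two events whose statements conflict and that are not ordered either way by happens-before; otherwise it is data-race-free. **The graph $G$.** The local graph of thread $i$ has nodes $\mathsf{Local}_i$, and edges $\sigma\to\mathsf{next}(\sigma)$ for $\sigma$ an acquire, release or barrier state and $\sigma\to\sigma'$ for $\sigma$ an nsync state and $(\sigma',\zeta')$ in the image of $\mathsf{update}(\sigma)$ for some $\zeta'$. For each $i$ let $\mathsf{Acquire}_i\cup\mathsf{Release}_i\subseteq R_i\subseteq\mathsf{Local}_i$ be such that every cycle of the local graph of thread $i$ meets $R_i$; for the least thread ID $i_0$ assume also $R_{i_0}\cap\mathsf{Barrier}_{i_0}=\emptyset$. The nodes of $G$ are pairs $\langle s,\mathbf a\rangle$ with $s$ a state and $\mathbf a_i\subseteq\mathsf{Stmt}_i$ for each $i$. There is an edge $\langle s,\mathbf a\rangle\xrightarrow{t}\langle s',\mathbf a'\rangle$ if and only if: $s\xrightarrow{t}s'$ is a transition; $\mathbf a'$ is obtained from $\mathbf a$ by adding $t$ to $\mathbf a_{\mathsf{tid}(t)}$ if $t$ is nsync, by emptying all components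 if $t=\mathsf{exit}_{i_0}$, by emptying $\mathbf a_{\mathsf{tid}(t)}$ if $t$ is any other statement and the local state of thread $\mathsf{tid}(t)$ in $s$ is in $R_{\mathsf{tid}(t)}$, and $\mathbf a'=\mathbf a$ otherwise; and, if some thread $i$ has an enabled statement at $s$ and local state not in $R_i$, then $\mathsf{tid}(t)$ is the least such $i$. An edge with label $t$ and target $\langle s',\mathbf a'\rangle$, where $i=\mathsf{tid}(t)$, detects a race if the local state of thread $i$ in $s'$ is in $R_i\cup\mathsf{Barrier}_i\cup\mathsf{Term}_i$ and some $t_1\in\mathbf a'_i$ conflicts with some $t_2\in\mathbf a'_j$, $j\ne i$. $G$ detects a race from $u$ if some edge reachable from $u$ detects a race. **Theorem.** Let $s_0$ be a state at which no barrier is partly exited, i.e. either the blocked threads are exactly the threads at barrier states, or all threads are at barrier states and none is blocked. Let $u_0=\langle s_0,\emptyset^{\mathsf{TID}}\rangle$ and suppose that only finitely many nodes of $G$ are reachable from $u_0$. Then: 1. $P$ has an execution from $s_0$ with a data race if and only if $G$ detects a race from $u_0$. 2. If $P$ has a data-race-free finite execution from $s_0$ to a state $s_f$ with $\mathsf{enabled}(s_f)=\emptyset$,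 then $G$ has a path from $u_0$ to a node with state component $s_f$. -/

import Mathlib

universe uT uK uS uL uN

/-- What a thread does at one of its local states: exactly one of the five kinds of local state
(acquire, release, barrier, nsync, terminal), together with the data attached to that kind.
In `nsync stmts _ update` the set `stmts` is the nonempty set of nsync statements available at the
local state, and only the values `update t ζ` with `t ∈ stmts` are ever used. -/
inductive LocalOp (Lock : Type uK) (Shared : Type uS) (Local : Type uL) (Nsync : Type uN) where
  | acquire (l : Lock) (next : Local)
  | release (l : Lock) (next : Local)
  | barrier (next : Local)
  | nsync (stmts : Set Nsync) (nonempty : stmts.Nonempty)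
      (update : Nsync → Shared → Local × Shared)
  | term

/-- A multithreaded program with set of thread IDs `T`.  `Local i` is the set of local states of
thread `i`, and `Nsync i` its set of non-synchronization statements. -/
structure Program (T : Type uT) where
  Lock : Type uK
  Shared : Type uS
  Local : T → Type uL
  Nsync : T → Type uN
  op : (i : T) → Local i → LocalOp Lock Shared (Local i) (Nsync i)

namespace Program

/-- The statements of thread `i`: lock statements, the barrier exit, and nsync statements. -/
inductive ThreadStmt {T : Type uT} (P : Program.{uT, uK, uS, uL, uN} T) (i : T) where
  | acquire (l : P.Lock)
  | release (l : P.Lock)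
  | exit
  | nsync (t : P.Nsync i)

/-- All statements: the disjoint union of the statements of the threads. -/
abbrev Stmt {T : Type uT} (P : Program.{uT, uK, uS, uL, uN} T) := Σ i : T, P.ThreadStmt i

/-- A global state.  In the lock state, `none` means that the lock is free, and `some i` that
thread `i` owns it.  `blocked` is the set of threads blocked at a barrier. -/
structure State {T : Type uT} (P : Program.{uT, uK, uS, uL, uN} T) where
  loc : (i : T) → P.Local i
  shared : P.Shared
  lock : P.Lock → Option T
  blocked : Finset T

section Semantics

variable {T : Type uT} (P : Program.{uT, uK, uS, uL, uN} T)

/-- Thread ID of a statement. -/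
def tid (t : P.Stmt) : T := t.1

def IsNsyncStmt (t : P.Stmt) : Prop := ∃ (i : T) (x : P.Nsync i), t = ⟨i, .nsync x⟩

def IsAcquireStmt (l : P.Lock) (t : P.Stmt) : Prop := ∃ i : T, t = ⟨i, .acquire l⟩

def IsReleaseStmt (l : P.Lock) (t : P.Stmt) : Prop := ∃ i : T, t = ⟨i, .release l⟩

def AcquireStates (i : T) : Set (P.Local i) := {σ | ∃ l n, P.op i σ = .acquire l n}

def ReleaseStates (i : T) : Set (P.Local i) := {σ | ∃ l n, P.op i σ = .release l n}

def BarrierStates (i : T) : Set (P.Local i) := {σ | ∃ n, P.op i σ = .barrier n}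

def TermStates (i : T) : Set (P.Local i) := {σ | P.op i σ = .term}

/-- Edges of the local graph of thread `i`. -/
def LocalEdge (i : T) (σ σ' : P.Local i) : Prop :=
  match P.op i σ with
  | .acquire _ n => σ' = n
  | .release _ n => σ' = n
  | .barrier n => σ' = n
  | .nsync stmts _ update => ∃ t ∈ stmts, ∃ ζ ζ', update t ζ = (σ', ζ')
  | .term => False

/-- The statements of thread `i` enabled at a state. -/
def enabledIn (s : P.State) (i : T) : Set (P.ThreadStmt i) :=
  match P.op i (s.loc i) with
  | .acquire l _ => {x | x = .acquire l ∧ s.lock l = none}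
  | .release l _ => {x | x = .release l ∧ s.lock l = some i}
  | .barrier _ => {x | x = .exit ∧ i ∉ s.blocked}
  | .nsync stmts _ _ => {x | ∃ t ∈ stmts, x = .nsync t}
  | .term => ∅

/-- The set of all statements enabled at a state. -/
def enabled (s : P.State) : Set P.Stmt := {t | t.2 ∈ P.enabledIn s t.1}

variable [LinearOrder T] [Fintype T]

open Classical in
/-- The state after thread `i` moves to local state `σ'`, with new shared state and lock state.
A thread that arrives at a barrier becomes blocked, unless it is the last one to arrive, in which
case all threads are released. -/
noncomputable def moveTo (s : P.State) (i : T) (σ' : P.Local i) (ζ' : P.Shared)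
    (θ' : P.Lock → Option T) : P.State where
  loc := Function.update s.loc i σ'
  shared := ζ'
  lock := θ'
  blocked :=
    if σ' ∈ P.BarrierStates i then
      if insert i s.blocked = Finset.univ then ∅ else insert i s.blocked
    else s.blocked

open Classical in
/-- Execution of a statement; only used for a statement that is enabled at `s`. -/
noncomputable def execute (s : P.State) (t : P.Stmt) : P.State :=
  match P.op t.1 (s.loc t.1), t.2 with
  | .acquire l n, _ => P.moveTo s t.1 n s.shared (Function.update s.lock l (some t.1))
  | .release l n, _ => P.moveTo s t.1 n s.shared (Function.update s.lock l none)
  | .barrier n, _ => P.moveTo s t.1 n s.shared s.lock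
  | .nsync _ _ update, .nsync x =>
      P.moveTo s t.1 (update x s.shared).1 (update x s.shared).2 s.lock
  | _, _ => s

/-- The transitions `s --t--> s'` of the program. -/
def Transition (s : P.State) (t : P.Stmt) (s' : P.State) : Prop :=
  t ∈ P.enabled s ∧ s' = P.execute s t

/-- Conflict relations. -/
structure IsConflictRelation (conflict : P.Stmt → P.Stmt → Prop) : Prop where
  symm : ∀ t₁ t₂, conflict t₁ t₂ → conflict t₂ t₁
  nsync : ∀ t₁ t₂, conflict t₁ t₂ → P.IsNsyncStmt t₁ ∧ P.IsNsyncStmt t₂ ∧ P.tid t₁ ≠ P.tid t₂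
  commute : ∀ t₁ t₂, P.IsNsyncStmt t₁ → P.IsNsyncStmt t₂ → P.tid t₁ ≠ P.tid t₂ →
    ¬ conflict t₁ t₂ → ∀ s : P.State, t₁ ∈ P.enabled s → t₂ ∈ P.enabled s →
      P.execute (P.execute s t₁) t₂ = P.execute (P.execute s t₂) t₁

/-- A finite or infinite execution `s₀ --t₁--> s₁ --t₂--> ⋯`, of length `len`.  Here `state k` is
`s_k` (meaningful for `k ≤ len`), and `label k` is `t_{k+1}` for `k < len`, and `none` from `len`
on. -/
structure Execution where
  len : ℕ∞
  state : ℕ → P.State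
  label : ℕ → Option P.Stmt
  label_eq_none_iff : ∀ k : ℕ, label k = none ↔ len ≤ (k : ℕ∞)
  transition : ∀ (k : ℕ) (t : P.Stmt), label k = some t → P.Transition (state k) t (state (k + 1))

end Semantics

/-- An event: a statement with a number. -/
abbrev Event {T : Type uT} (P : Program.{uT, uK, uS, uL, uN} T) := P.Stmt × ℕ

namespace Execution

variable {T : Type uT} [LinearOrder T] [Fintype T] {P : Program.{uT, uK, uS, uL, uN} T}
  (α : P.Execution)

open Classical in
/-- `e` is the event at (zero-based) position `k` of the trace of `α`: the statement at position
`k`, numbered by how many statements of its thread occur at positions `0, …, k`. -/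
def EventAt (k : ℕ) (e : P.Event) : Prop :=
  α.label k = some e.1 ∧
    e.2 = ((Finset.range (k + 1)).filter
      (fun j => ∃ t, α.label j = some t ∧ P.tid t = P.tid e.1)).card

/-- The set of events of `α`. -/
def events : Set P.Event := {e | ∃ k, α.EventAt k e}

def IntraThread (e e' : P.Event) : Prop :=
  e ∈ α.events ∧ e' ∈ α.events ∧ P.tid e.1 = P.tid e'.1 ∧ e.2 < e'.2

def ReleaseAcquire (e e' : P.Event) : Prop :=
  ∃ (l : P.Lock) (i j : ℕ), i < j ∧ α.EventAt i e ∧ α.EventAt j e' ∧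
    P.IsReleaseStmt l e.1 ∧ P.IsAcquireStmt l e'.1 ∧
    ∀ k t, i < k → k < j → α.label k = some t → ¬ P.IsAcquireStmt l t

/-- The number of barrier exit events in the thread of `e` preceding or including `e`. -/
noncomputable def epoch (e : P.Event) : ℕ :=
  Set.ncard {e' : P.Event | e' ∈ α.events ∧ ∃ j, 1 ≤ j ∧ j ≤ e.2 ∧ e' = (⟨P.tid e.1, .exit⟩, j)}

def BarrierRel (e e' : P.Event) : Prop :=
  e ∈ α.events ∧ e' ∈ α.events ∧ α.epoch e < α.epoch e'

/-- The happens-before relation of `α`. -/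
def HB : P.Event → P.Event → Prop :=
  Relation.TransGen
    (fun e e' => α.IntraThread e e' ∨ α.ReleaseAcquire e e' ∨ α.BarrierRel e e')

/-- The data race relation of `α`. -/
def DR (conflict : P.Stmt → P.Stmt → Prop) (e e' : P.Event) : Prop :=
  e ∈ α.events ∧ e' ∈ α.events ∧ conflict e.1 e'.1 ∧ ¬ α.HB e e' ∧ ¬ α.HB e' e

def HasDataRace (conflict : P.Stmt → P.Stmt → Prop) : Prop := ∃ e e', α.DR conflict e e'

end Execution

section Graph

variable {T : Type uT} [LinearOrder T] [Fintype T] (P : Program.{uT, uK, uS, uL, uN} T)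

/-- The additional information given with a program: sets `R i` of local states that contain all
acquire and release states and meet every cycle (closed path of positive length) of the local
graph. -/
structure IsReductionSets (R : (i : T) → Set (P.Local i)) : Prop where
  acquire_subset : ∀ i, P.AcquireStates i ⊆ R i
  release_subset : ∀ i, P.ReleaseStates i ⊆ R i
  cycle : ∀ (i : T) (n : ℕ) (c : ℕ → P.Local i), 0 < n → c n = c 0 →
    (∀ k < n, P.LocalEdge i (c k) (c (k + 1))) → ∃ k < n, c k ∈ R i

/-- Nodes of the race-detecting state graph: a state, and a set of statements for each thread. -/
@[ext]
structure Node where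
  state : P.State
  hist : (i : T) → Set (P.ThreadStmt i)

/-- The node `⟨s, ∅, …, ∅⟩`. -/
def initNode (s : P.State) : P.Node := ⟨s, fun _ => ∅⟩

variable (R : (i : T) → Set (P.Local i))

open Classical in
/-- The statement sets after execution of `t` at state `s`: an nsync statement is added to the set
of its thread; the barrier exit of the least thread empties all the sets; otherwise the set of the
executing thread is emptied if that thread is at a state in `R`. -/
noncomputable def nextHist (s : P.State) (a : (i : T) → Set (P.ThreadStmt i)) (t : P.Stmt) :
    (i : T) → Set (P.ThreadStmt i) :=
  if P.IsNsyncStmt t then Function.update a t.1 (insert t.2 (a t.1))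
  else if t.2 = .exit ∧ (∀ j, t.1 ≤ j) then fun _ => ∅
  else if s.loc t.1 ∈ R t.1 then Function.update a t.1 ∅
  else a

/-- Thread `i` is not at a state in `R i` and has an enabled statement. -/
def Normal (s : P.State) (i : T) : Prop := s.loc i ∉ R i ∧ (P.enabledIn s i).Nonempty

/-- The edges of the race-detecting state graph. -/
def Edge (u : P.Node) (t : P.Stmt) (v : P.Node) : Prop :=
  P.Transition u.state t v.state ∧
  v.hist = P.nextHist R u.state u.hist t ∧
  ((∃ i, P.Normal R u.state i) → IsLeast {i | P.Normal R u.state i} (P.tid t))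

/-- There is a path in the race-detecting state graph from `u` to `v`. -/
def Reachable : P.Node → P.Node → Prop := Relation.ReflTransGen (fun u v => ∃ t, P.Edge R u t v)

/-- Thread `i` detects a race in the node `u`. -/
def ThreadDetects (conflict : P.Stmt → P.Stmt → Prop) (u : P.Node) (i : T) : Prop :=
  ∃ j, j ≠ i ∧ ∃ t₁ ∈ u.hist i, ∃ t₂ ∈ u.hist j, conflict ⟨i, t₁⟩ ⟨j, t₂⟩

/-- An edge with label `t` and target `v` detects a race. -/
def EdgeDetects (conflict : P.Stmt → P.Stmt → Prop) (t : P.Stmt) (v : P.Node) : Prop :=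
  v.state.loc (P.tid t) ∈ R (P.tid t) ∪ P.BarrierStates (P.tid t) ∪ P.TermStates (P.tid t) ∧
  P.ThreadDetects conflict v (P.tid t)

/-- The race-detecting state graph detects a race from `u`. -/
def DetectsRaceFrom (conflict : P.Stmt → P.Stmt → Prop) (u : P.Node) : Prop :=
  ∃ v t v', P.Reachable R u v ∧ P.Edge R v t v' ∧ P.EdgeDetects R conflict t v'

/-- No barrier is partly exited at `s`: the blocked threads are exactly the threads at barrier
states, or else all threads are at barrier states and none of them is blocked. -/
def BarrierConsistent (s : P.State) : Prop :=
  (∀ i, i ∈ s.blocked ↔ s.loc i ∈ P.BarrierStates i) ∨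
  (s.blocked = ∅ ∧ ∀ i, s.loc i ∈ P.BarrierStates i)

end Graph

end Program

set_option linter.unusedSectionVars false

/-! A thread is normal if it is outside `R` and has an enabled statement. Since `R` contains all
lock states, such a statement is an nsync statement or a barrier exit, and no other thread can
disable it. By `execute_swap` it commutes past non-conflicting steps of other threads. So a given
run can be adapted to the scheduling rule of the graph: the first step of the least normal thread in
the run is pulled to the front, or, if the run has none, one is inserted in front. Only a conflict
obstructs this, and then a shorter run already has two conflicting statements enabled at its end.
Insertions cannot go on forever: a cycle of normal steps would project to a local cycle avoiding
`R`, and only finitely many nodes are reachable (`acc_normalEdge`).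

From a race to its detection: take a race whose second event is earliest, and execute only events
that happen before one of the two racing events. This leads to a state at which both statements are
enabled (`exists_coenabled`). `detectsRaceFrom_aux` adapts that run to the graph: one of two
conflicting statements is executed and stays recorded until the other is executed too. Then
`detectsRaceFrom_of_hist` continues until the second thread is at a state where races are checked.

From detection to a race: since a recorded statement was executed, its thread has executed only
nsync statements, and it has exited barriers at least as often as every other thread (`PathInv`).
Hence nothing in another thread happens after it (`PathInv.not_hb`), and two recorded conflicting
statements race. This needs every record to be emptied before any thread exits a completed barrier,
which holds because the least thread is normal when it can exit, and so exits first (`NodeInv`).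

For final states, `reachable_of_raceFree` replays the events of the execution in an order allowed by
the graph. Nothing has to be inserted, because an enabled statement of a normal thread that never
moves again would still be enabled at the end. The first remaining event of a normal thread is
minimal for happens-before among the remaining events, so race-freedom excludes a conflict with the
events that it is moved past. -/

namespace Program

/-! ### Single steps, blocked threads, and commutation. -/

section Basic

open scoped Classical

variable {T : Type uT} [LinearOrder T] [Fintype T] {P : Program.{uT, uK, uS, uL, uN} T}

/-- The blocked set after thread `i` has moved; `b` says whether it has arrived at a barrier. -/
noncomputable def arrive (i : T) (b : Prop) [Decidable b] (w : Finset T) : Finset T :=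
  if b then if insert i w = Finset.univ then ∅ else insert i w else w

/-- Neither arrival alone completes the barrier, since the other thread is still outside `w`. Only
the second arrival can reset the set, and it sees the same union in both orders. -/
theorem arrive_comm {i j : T} (hij : i ≠ j) (b b' : Prop) [Decidable b] [Decidable b']
    {w : Finset T} (hi : i ∉ w) (hj : j ∉ w) :
    arrive i b (arrive j b' w) = arrive j b' (arrive i b w) := by
  have h₁ : insert i w ≠ Finset.univ := fun h => by
    have := Finset.mem_univ j
    rw [← h] at this
    simp_all [eq_comm]
  have h₂ : insert j w ≠ Finset.univ := fun h => by
    have := Finset.mem_univ i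
    rw [← h] at this
    simp_all [eq_comm]
  by_cases hb : b <;> by_cases hb' : b' <;> simp [arrive, hb, hb', h₁, h₂, Finset.insert_comm]

theorem mem_of_mem_arrive {i j : T} (hij : j ≠ i) {b : Prop} [Decidable b] {w : Finset T}
    (h : j ∈ arrive i b w) : j ∈ w := by
  unfold arrive at h
  split_ifs at h <;> simp_all

theorem moveTo_eq (s : P.State) (i : T) (σ : P.Local i) (ζ : P.Shared) (θ : P.Lock → Option T) :
    P.moveTo s i σ ζ θ =
      ⟨Function.update s.loc i σ, ζ, θ, arrive i (σ ∈ P.BarrierStates i) s.blocked⟩ := rfl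

theorem enabled_acquire {s : P.State} {t : P.Stmt} {l n}
    (h : P.op t.1 (s.loc t.1) = .acquire l n) :
    t ∈ P.enabled s ↔ t.2 = .acquire l ∧ s.lock l = none := by
  simp [enabled, enabledIn, h]

theorem enabled_release {s : P.State} {t : P.Stmt} {l n}
    (h : P.op t.1 (s.loc t.1) = .release l n) :
    t ∈ P.enabled s ↔ t.2 = .release l ∧ s.lock l = some t.1 := by
  simp [enabled, enabledIn, h]

theorem enabled_barrier {s : P.State} {t : P.Stmt} {n}
    (h : P.op t.1 (s.loc t.1) = .barrier n) :
    t ∈ P.enabled s ↔ t.2 = .exit ∧ t.1 ∉ s.blocked := by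
  simp [enabled, enabledIn, h]

theorem enabled_nsync {s : P.State} {t : P.Stmt} {st ne up}
    (h : P.op t.1 (s.loc t.1) = .nsync st ne up) :
    t ∈ P.enabled s ↔ ∃ x ∈ st, t.2 = .nsync x := by
  simp [enabled, enabledIn, h]

theorem execute_of_acquire {s : P.State} {t : P.Stmt} {l n}
    (h : P.op t.1 (s.loc t.1) = .acquire l n) :
    P.execute s t = P.moveTo s t.1 n s.shared (Function.update s.lock l (some t.1)) := by
  simp [execute, h]

theorem execute_of_release {s : P.State} {t : P.Stmt} {l n}
    (h : P.op t.1 (s.loc t.1) = .release l n) :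
    P.execute s t = P.moveTo s t.1 n s.shared (Function.update s.lock l none) := by
  simp [execute, h]

theorem execute_of_barrier {s : P.State} {t : P.Stmt} {n}
    (h : P.op t.1 (s.loc t.1) = .barrier n) :
    P.execute s t = P.moveTo s t.1 n s.shared s.lock := by
  simp [execute, h]

theorem execute_of_nsync {s : P.State} {t : P.Stmt} {st ne up} {x : P.Nsync t.1}
    (h : P.op t.1 (s.loc t.1) = .nsync st ne up) (hx : t.2 = .nsync x) :
    P.execute s t = P.moveTo s t.1 (up x s.shared).1 (up x s.shared).2 s.lock := by
  simp only [execute, h, hx]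

/-- The four kinds of enabled statements. -/
theorem enabled_cases {s : P.State} {t : P.Stmt} (ht : t ∈ P.enabled s) :
    (∃ l n, P.op t.1 (s.loc t.1) = .acquire l n ∧ t.2 = .acquire l ∧ s.lock l = none ∧
      P.execute s t = P.moveTo s t.1 n s.shared (Function.update s.lock l (some t.1))) ∨
    (∃ l n, P.op t.1 (s.loc t.1) = .release l n ∧ t.2 = .release l ∧ s.lock l = some t.1 ∧
      P.execute s t = P.moveTo s t.1 n s.shared (Function.update s.lock l none)) ∨
    (∃ n, P.op t.1 (s.loc t.1) = .barrier n ∧ t.2 = .exit ∧ t.1 ∉ s.blocked ∧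
      P.execute s t = P.moveTo s t.1 n s.shared s.lock) ∨
    (∃ (st : Set (P.Nsync t.1)) (ne : st.Nonempty)
      (up : P.Nsync t.1 → P.Shared → P.Local t.1 × P.Shared) (x : P.Nsync t.1), P.op t.1 (s.loc t.1) = .nsync st ne up ∧ x ∈ st ∧ t.2 = .nsync x ∧
      P.execute s t =
        P.moveTo s t.1 (up x s.shared).1 (up x s.shared).2 s.lock) := by
  obtain ⟨i, x⟩ := t
  rcases h : P.op i (s.loc i) with ⟨l, n⟩ | ⟨l, n⟩ | n | ⟨st, ne, up⟩ | _
  · have := (enabled_acquire (t := ⟨i, x⟩) h).1 ht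
    exact .inl ⟨l, n, rfl, this.1, this.2, by simp [execute, h]⟩
  · have := (enabled_release (t := ⟨i, x⟩) h).1 ht
    exact .inr (.inl ⟨l, n, rfl, this.1, this.2, by simp [execute, h]⟩)
  · have := (enabled_barrier (t := ⟨i, x⟩) h).1 ht
    exact .inr (.inr (.inl ⟨n, rfl, this.1, this.2, by simp [execute, h]⟩))
  · obtain ⟨y, hy, hxy⟩ := (enabled_nsync (t := ⟨i, x⟩) h).1 ht
    exact .inr (.inr (.inr ⟨st, ne, up, y, rfl, hy, hxy, execute_of_nsync (t := ⟨i, x⟩) h hxy⟩))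
  · simp [enabled, enabledIn, h] at ht

/-- Every enabled statement moves its thread. -/
theorem exists_moveTo {s : P.State} {t : P.Stmt} (ht : t ∈ P.enabled s) :
    ∃ σ ζ θ, P.execute s t = P.moveTo s t.1 σ ζ θ := by
  rcases enabled_cases ht with ⟨_, _, _, _, _, h⟩ | ⟨_, _, _, _, _, h⟩ | ⟨_, _, _, _, h⟩ |
    ⟨_, _, _, _, _, _, _, h⟩ <;> exact ⟨_, _, _, h⟩

theorem loc_execute_of_ne {s : P.State} {t : P.Stmt} (ht : t ∈ P.enabled s) {j : T}
    (hj : j ≠ t.1) : (P.execute s t).loc j = s.loc j := by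
  obtain ⟨σ, ζ, θ, h⟩ := exists_moveTo ht
  simp [h, moveTo_eq, hj]

theorem mem_blocked_of_execute {s : P.State} {t : P.Stmt} (ht : t ∈ P.enabled s) {j : T}
    (hj : j ≠ t.1) (h : j ∈ (P.execute s t).blocked) : j ∈ s.blocked := by
  obtain ⟨σ, ζ, θ, h'⟩ := exists_moveTo ht
  rw [h', moveTo_eq] at h
  exact mem_of_mem_arrive hj h

/-- Blocked threads are at barriers. -/
def BlockedAtBarrier (s : P.State) : Prop := ∀ i ∈ s.blocked, s.loc i ∈ P.BarrierStates i

/-- Thread `i` is at a barrier and may exit it. -/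
def Exiting (s : P.State) (i : T) : Prop := s.loc i ∈ P.BarrierStates i ∧ i ∉ s.blocked

theorem notMem_blocked_of_enabled {s : P.State} (hs : BlockedAtBarrier s) {t : P.Stmt}
    (ht : t ∈ P.enabled s) : t.1 ∉ s.blocked := by
  intro hb
  obtain ⟨n, hn⟩ := hs _ hb
  exact ((enabled_barrier hn).1 ht).2 hb

/-- The effect of a step on the blocked set: the barrier is completed, or else only the moving
thread changes its status. -/
theorem execute_blocked {s : P.State} (hs : BlockedAtBarrier s) {t : P.Stmt}
    (ht : t ∈ P.enabled s) :
    ((∀ j, j ≠ t.1 → j ∈ s.blocked) ∧ ∀ j, Exiting (P.execute s t) j) ∨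
    ((∀ j, j ≠ t.1 → (j ∈ (P.execute s t).blocked ↔ j ∈ s.blocked)) ∧
      (t.1 ∈ (P.execute s t).blocked ↔ (P.execute s t).loc t.1 ∈ P.BarrierStates t.1)) := by
  have hb := notMem_blocked_of_enabled hs ht
  obtain ⟨σ, ζ, θ, h⟩ := exists_moveTo ht
  by_cases hσ : σ ∈ P.BarrierStates t.1
  · by_cases hu : insert t.1 s.blocked = Finset.univ
    · have hall : ∀ j, j ≠ t.1 → j ∈ s.blocked := fun j hj => by
        have := Finset.mem_univ j
        rw [← hu] at this
        simpa [hj] using this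
      refine .inl ⟨hall, fun j => ⟨?_, ?_⟩⟩
      · by_cases hj : j = t.1
        · subst hj
          simpa [h, moveTo_eq] using hσ
        · rw [loc_execute_of_ne ht hj]
          exact hs j (hall j hj)
      · simp [h, moveTo_eq, arrive, hσ, hu]
    · refine .inr ⟨fun j hj => ?_, ?_⟩
      · simp [h, moveTo_eq, arrive, hσ, hu, hj]
      · simp [h, moveTo_eq, arrive, hσ, hu]
  · refine .inr ⟨fun j hj => ?_, ?_⟩
    · simp [h, moveTo_eq, arrive, hσ]
    · simp [h, moveTo_eq, arrive, hσ, hb]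

theorem BlockedAtBarrier.execute {s : P.State} (hs : BlockedAtBarrier s) {t : P.Stmt}
    (ht : t ∈ P.enabled s) : BlockedAtBarrier (P.execute s t) := by
  intro j hj
  rcases execute_blocked hs ht with ⟨_, h⟩ | ⟨h₁, h₂⟩
  · exact (h j).1
  · by_cases hjt : j = t.1
    · subst hjt; exact h₂.1 hj
    · rw [loc_execute_of_ne ht hjt]
      exact hs j ((h₁ j hjt).1 hj)

theorem BarrierConsistent.blockedAtBarrier {s : P.State} (hs : P.BarrierConsistent s) :
    BlockedAtBarrier s := by
  intro i hi
  rcases hs with h | h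
  · exact (h i).1 hi
  · simp [h.1] at hi

/-- Commutation of two steps of different threads. -/
theorem execute_swap {conflict : P.Stmt → P.Stmt → Prop} (hc : P.IsConflictRelation conflict)
    {s : P.State} (hs : BlockedAtBarrier s) {x y : P.Stmt} (hxy : x.1 ≠ y.1)
    (hx : x ∈ P.enabled s) (hy : y ∈ P.enabled s) (hy' : y ∈ P.enabled (P.execute s x))
    (hn : ¬ conflict x y) :
    x ∈ P.enabled (P.execute s y) ∧
      P.execute (P.execute s y) x = P.execute (P.execute s x) y := by
  have hbx := notMem_blocked_of_enabled hs hx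
  have hby := notMem_blocked_of_enabled hs hy
  have hlx : (P.execute s y).loc x.1 = s.loc x.1 := loc_execute_of_ne hy hxy
  have hly : (P.execute s x).loc y.1 = s.loc y.1 := loc_execute_of_ne hx hxy.symm
  have hbx' : x.1 ∉ (P.execute s y).blocked := fun h => hbx (mem_blocked_of_execute hy hxy h)
  rcases enabled_cases hx with ⟨l, n, ox, ex, lx, qx⟩ | ⟨l, n, ox, ex, lx, qx⟩ |
    ⟨n, ox, ex, wx, qx⟩ | ⟨st, ne, up, x', ox, sx, ex, qx⟩ <;>
  rcases enabled_cases hy with ⟨l', n', oy, ey, ly, qy⟩ | ⟨l', n', oy, ey, ly, qy⟩ |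
    ⟨n', oy, ey, wy, qy⟩ | ⟨st', ne', up', y', oy, sy, ey, qy⟩
  -- Two nsync statements are the only pair that needs the conflict relation: in every other case at
  -- most one of the steps touches the shared state.
  case inr.inr.inr.inr.inr.inr =>
    have e : P.execute (P.execute s y) x = P.execute (P.execute s x) y :=
      (hc.commute x y ⟨x.1, x', by rw [← ex]⟩ ⟨y.1, y', by rw [← ey]⟩ hxy hn s hx hy).symm
    exact ⟨(enabled_nsync (hlx ▸ ox)).2 ⟨x', sx, ex⟩, e⟩
  all_goals
    rw [← hlx] at ox
    rw [← hly] at oy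
    first
    | rw [execute_of_acquire ox, enabled_acquire ox]
    | rw [execute_of_release ox, enabled_release ox]
    | rw [execute_of_barrier ox, enabled_barrier ox]
    | rw [execute_of_nsync ox ex, enabled_nsync ox]
    first
    | rw [execute_of_acquire oy]; rw [enabled_acquire oy] at hy'
    | rw [execute_of_release oy]; rw [enabled_release oy] at hy'
    | rw [execute_of_barrier oy]; rw [enabled_barrier oy] at hy'
    | rw [execute_of_nsync oy ey]; rw [enabled_nsync oy] at hy'
    refine ⟨?_, ?_⟩
  case' inr.inr.inr.inl.refine_1 | inr.inr.inr.inr.inl.refine_1 | inr.inr.inr.inr.inr.inl.refine_1 =>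
    exact ⟨x', sx, ex⟩
  all_goals
    rw [qy]
    try rw [qx] at hy' ⊢
    first
    | have c₁ := fun a b => Function.update_comm hxy a b s.loc
      have c₂ := fun b b' => arrive_comm hxy b b' hbx hby
      simp_all [moveTo_eq]
      done
    | rcases eq_or_ne l l' with hl | hl
      -- On a common lock, one acquire disables the other, two releases would need two owners, and
      -- an acquire and a release are never both enabled.
      · subst hl
        exfalso
        simp_all [moveTo_eq]
      · have c₁ := fun a b => Function.update_comm hxy a b s.loc
        have c₂ := fun b b' => arrive_comm hxy b b' hbx hby
        have c₃ := fun a b => Function.update_comm hl a b s.lock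
        have hl' := hl.symm
        simp_all [moveTo_eq]

end Basic

/-! ### Finite runs, and statements that other threads cannot disable. -/

section Runs

variable {T : Type uT} [LinearOrder T] [Fintype T] {P : Program.{uT, uK, uS, uL, uN} T}

theorem isNsyncStmt_iff {t : P.Stmt} : P.IsNsyncStmt t ↔ ∃ x, t.2 = .nsync x := by
  obtain ⟨i, x⟩ := t
  constructor
  · rintro ⟨j, y, h⟩
    cases h
    exact ⟨y, rfl⟩
  · rintro ⟨y, h⟩
    exact ⟨i, y, Sigma.ext rfl (heq_of_eq h)⟩

/-- Statements that are not disabled by other threads. -/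
def Persistent (t : P.Stmt) : Prop := P.IsNsyncStmt t ∨ t.2 = .exit

theorem IsNsyncStmt.enabled_congr {t : P.Stmt} (ht : P.IsNsyncStmt t) {s s' : P.State}
    (h : s.loc t.1 = s'.loc t.1) : t ∈ P.enabled s ↔ t ∈ P.enabled s' := by
  obtain ⟨x, hx⟩ := isNsyncStmt_iff.1 ht
  simp only [enabled, enabledIn, Set.mem_ofPred_eq, ← h]
  rcases P.op t.1 (s.loc t.1) with ⟨l, n⟩ | ⟨l, n⟩ | n | ⟨st, ne, up⟩ | _ <;> simp [hx]

theorem enabled_exit_iff {t : P.Stmt} (ht : t.2 = .exit) {s : P.State} :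
    t ∈ P.enabled s ↔ Exiting s t.1 := by
  simp only [enabled, enabledIn, Set.mem_ofPred_eq, Exiting, BarrierStates]
  rcases P.op t.1 (s.loc t.1) with ⟨l, n⟩ | ⟨l, n⟩ | n | ⟨st, ne, up⟩ | _ <;> simp [ht]

/-- Whether an nsync statement is enabled depends only on the local state of its thread, and no step
adds another thread to the blocked set. -/
theorem Persistent.enabled_execute {y : P.Stmt} (hp : Persistent y) {s : P.State}
    (hy : y ∈ P.enabled s) {x : P.Stmt} (hx : x ∈ P.enabled s) (hxy : x.1 ≠ y.1) :
    y ∈ P.enabled (P.execute s x) := by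
  have hl := loc_execute_of_ne hx hxy.symm
  rcases hp with hp | hp
  · exact (hp.enabled_congr hl).2 hy
  · rw [enabled_exit_iff hp] at hy ⊢
    exact ⟨hl ▸ hy.1, fun h => hy.2 (mem_blocked_of_execute hx hxy.symm h)⟩

/-- `Run s l f`: the statements `l` can be executed from `s`, and lead to `f`. -/
def Run : P.State → List P.Stmt → P.State → Prop
  | s, [], f => s = f
  | s, t :: l, f => t ∈ P.enabled s ∧ Run (P.execute s t) l f

theorem run_append {s f : P.State} {l l' : List P.Stmt} :
    Run s (l ++ l') f ↔ ∃ g, Run s l g ∧ Run g l' f := by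
  induction l generalizing s with
  | nil => simp [Run]
  | cons t l ih => simp [Run, ih, and_assoc]

theorem Run.blockedAtBarrier {s f : P.State} {l : List P.Stmt} (h : Run s l f)
    (hs : BlockedAtBarrier s) : BlockedAtBarrier f := by
  induction l generalizing s with
  | nil => exact h ▸ hs
  | cons t l ih => exact ih h.2 (hs.execute h.1)

theorem Run.loc_eq {s f : P.State} {l : List P.Stmt} (h : Run s l f) {i : T}
    (hi : ∀ t ∈ l, t.1 ≠ i) : f.loc i = s.loc i := by
  induction l generalizing s with
  | nil => rw [show s = f from h]
  | cons t l ih =>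
    rw [ih h.2 fun t' ht' => hi t' (List.mem_cons_of_mem _ ht')]
    exact loc_execute_of_ne h.1 (hi t List.mem_cons_self).symm

theorem Run.mem_blocked {s f : P.State} {l : List P.Stmt} (h : Run s l f) {i : T}
    (hi : ∀ t ∈ l, t.1 ≠ i) (hf : i ∈ f.blocked) : i ∈ s.blocked := by
  induction l generalizing s with
  | nil => exact (show s = f from h) ▸ hf
  | cons t l ih =>
    exact mem_blocked_of_execute h.1 (hi t List.mem_cons_self).symm
      (ih h.2 fun t' ht' => hi t' (List.mem_cons_of_mem _ ht'))

theorem Run.enabled_nsync_iff {s f : P.State} {l : List P.Stmt} (h : Run s l f) {y : P.Stmt}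
    (hy : P.IsNsyncStmt y) (hi : ∀ t ∈ l, t.1 ≠ y.1) : y ∈ P.enabled f ↔ y ∈ P.enabled s :=
  hy.enabled_congr (h.loc_eq hi)

theorem Persistent.enabled_run {y : P.Stmt} (hp : Persistent y) {s f : P.State}
    {l : List P.Stmt} (h : Run s l f) (hl : ∀ t ∈ l, t.1 ≠ y.1) (hy : y ∈ P.enabled s) :
    y ∈ P.enabled f := by
  induction l generalizing s with
  | nil => exact (show s = f from h) ▸ hy
  | cons t l ih =>
    exact ih h.2 (fun t' ht' => hl t' (List.mem_cons_of_mem _ ht'))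
      (hp.enabled_execute hy h.1 (hl t List.mem_cons_self))

variable {conflict : P.Stmt → P.Stmt → Prop}

/-- A persistent statement that conflicts with no statement of a run commutes with the run. -/
theorem Run.commute (hc : P.IsConflictRelation conflict) {s f : P.State} {l : List P.Stmt}
    (h : Run s l f) (hs : BlockedAtBarrier s) {y : P.Stmt} (hp : Persistent y)
    (hy : y ∈ P.enabled s) (hl : ∀ t ∈ l, t.1 ≠ y.1) (hn : ∀ t ∈ l, ¬ conflict t y) :
    Run (P.execute s y) l (P.execute f y) := by
  induction l generalizing s with
  | nil => exact congrArg (P.execute · y) h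
  | cons t l ih =>
    have hy' := hp.enabled_execute hy h.1 (hl t List.mem_cons_self)
    obtain ⟨h₁, h₂⟩ := execute_swap hc hs (hl t List.mem_cons_self) h.1 hy hy'
      (hn t List.mem_cons_self)
    refine ⟨h₁, h₂ ▸ ih h.2 (hs.execute h.1) hy'
      (fun t' ht' => hl t' (List.mem_cons_of_mem _ ht'))
      (fun t' ht' => hn t' (List.mem_cons_of_mem _ ht'))⟩

/-- A persistent statement either commutes with a run of other threads, or some prefix of the run
leads to a state at which two conflicting statements are enabled. -/
theorem Run.commute_or_conflict (hc : P.IsConflictRelation conflict) {s f : P.State}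
    {l : List P.Stmt} (h : Run s l f) (hs : BlockedAtBarrier s) {y : P.Stmt} (hp : Persistent y)
    (hy : y ∈ P.enabled s) (hl : ∀ t ∈ l, t.1 ≠ y.1) :
    (∃ l' g x, l'.length < l.length ∧ Run s l' g ∧ x ∈ P.enabled g ∧ y ∈ P.enabled g ∧
      conflict x y) ∨
    Run (P.execute s y) l (P.execute f y) := by
  by_cases hn : ∃ t ∈ l, conflict t y
  · obtain ⟨t, ht, hty⟩ := hn
    obtain ⟨l₁, l₂, rfl⟩ := List.append_of_mem ht
    obtain ⟨g, hg, hg'⟩ := run_append.1 h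
    exact .inl ⟨l₁, g, t, by simp, hg, hg'.1,
      hp.enabled_run hg (fun t' ht' => hl t' (List.mem_append_left _ ht')) hy, hty⟩
  · push Not at hn
    exact .inr (h.commute hc hs hp hy hl hn)

theorem exists_first {α : Type*} (p : α → Prop) (l : List α) :
    (∀ t ∈ l, ¬ p t) ∨ ∃ l₁ y l₂, l = l₁ ++ y :: l₂ ∧ p y ∧ ∀ t ∈ l₁, ¬ p t := by
  induction l with
  | nil => simp
  | cons t l ih =>
    by_cases ht : p t
    · exact .inr ⟨[], t, l, rfl, ht, by simp⟩
    · rcases ih with ih | ⟨l₁, y, l₂, rfl, hy, h⟩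
      · exact .inl (by simpa [ht] using ih)
      · exact .inr ⟨t :: l₁, y, l₂, rfl, hy, by simpa [ht] using h⟩

end Runs

/-! ### Normal threads, the invariant of the graph at barriers, and termination of normal steps. -/

section NormalSteps

variable {T : Type uT} [LinearOrder T] [Fintype T] {P : Program.{uT, uK, uS, uL, uN} T}
  {conflict : P.Stmt → P.Stmt → Prop} {R : (i : T) → Set (P.Local i)}

theorem normal_of_enabled {s : P.State} {t : P.Stmt} (ht : t ∈ P.enabled s)
    (hR : s.loc t.1 ∉ R t.1) : P.Normal R s t.1 := ⟨hR, t.2, ht⟩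

theorem Normal.persistent (hR : P.IsReductionSets R) {s : P.State} {t : P.Stmt}
    (hn : P.Normal R s t.1) (ht : t ∈ P.enabled s) : Persistent t := by
  rcases enabled_cases ht with ⟨l, n, h, _⟩ | ⟨l, n, h, _⟩ | ⟨n, _, h, _⟩ |
    ⟨_, _, _, x, _, _, h, _⟩
  · exact absurd (hR.acquire_subset _ ⟨l, n, h⟩) hn.1
  · exact absurd (hR.release_subset _ ⟨l, n, h⟩) hn.1
  · exact .inr h
  · exact .inl (isNsyncStmt_iff.2 ⟨x, h⟩)

theorem Normal.exists_enabled {s : P.State} {i : T} (h : P.Normal R s i) :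
    ∃ t ∈ P.enabled s, t.1 = i :=
  let ⟨x, hx⟩ := h.2
  ⟨⟨i, x⟩, hx, rfl⟩

theorem exists_isLeast_normal {s : P.State} (h : ∃ i, P.Normal R s i) :
    ∃ i, IsLeast {i | P.Normal R s i} i := by
  classical
  have hne : (Finset.univ.filter (P.Normal R s)).Nonempty := by
    obtain ⟨i, hi⟩ := h
    exact ⟨i, by simpa using hi⟩
  refine ⟨Finset.min' _ hne, ?_, fun j hj => Finset.min'_le (Finset.univ.filter (P.Normal R s)) j
    (Finset.mem_filter.2 ⟨Finset.mem_univ _, hj⟩)⟩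
  exact (Finset.mem_filter.1 (Finset.min'_mem _ hne)).2

variable (R) in
/-- The target of the edge with label `t` from `u`. -/
noncomputable def stepNode (u : P.Node) (t : P.Stmt) : P.Node :=
  ⟨P.execute u.state t, P.nextHist R u.state u.hist t⟩

theorem edge_stepNode {u : P.Node} {t : P.Stmt} (ht : t ∈ P.enabled u.state)
    (h : (∃ i, P.Normal R u.state i) → IsLeast {i | P.Normal R u.state i} t.1) :
    P.Edge R u t (stepNode R u t) := ⟨⟨ht, rfl⟩, rfl, h⟩

theorem Edge.eq_stepNode {u v : P.Node} {t : P.Stmt} (h : P.Edge R u t v) :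
    v = stepNode R u t := Node.ext h.1.2 h.2.1

/-- Invariant of reachable nodes: if the least thread may exit a barrier, no thread has exited
it yet. -/
def NodeInv (u : P.Node) : Prop :=
  BlockedAtBarrier u.state ∧
    ∀ i, (∀ j, i ≤ j) → Exiting u.state i → ∀ j, Exiting u.state j

/-- The least thread has priority at barriers. -/
theorem Edge.eq_of_exiting (hexit : ∀ i : T, (∀ j, i ≤ j) → Disjoint (P.BarrierStates i) (R i))
    {u v : P.Node} {t : P.Stmt} (h : P.Edge R u t v) {i : T} (hi : ∀ j, i ≤ j)
    (he : Exiting u.state i) : t.1 = i := by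
  have hn : P.Normal R u.state i :=
    ⟨fun hr => Set.disjoint_left.1 (hexit i hi) he.1 hr, .exit,
      (enabled_exit_iff (t := ⟨i, .exit⟩) rfl).2 he⟩
  exact le_antisymm ((h.2.2 ⟨i, hn⟩).2 hn) (hi _)

/-- If the step completes a barrier, all threads may exit. Otherwise a thread that has just moved is
blocked if it is at a barrier; and if another thread has moved, the least thread could already exit
before, and would have had priority. -/
theorem NodeInv.edge (hexit : ∀ i : T, (∀ j, i ≤ j) → Disjoint (P.BarrierStates i) (R i))
    {u v : P.Node} (hu : NodeInv u) {t : P.Stmt} (h : P.Edge R u t v) : NodeInv v := by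
  have ht := h.1.1
  rw [h.eq_stepNode]
  refine ⟨hu.1.execute ht, fun i hi he => ?_⟩
  rcases execute_blocked hu.1 ht with ⟨_, h'⟩ | ⟨h₁, h₂⟩
  · exact h'
  · by_cases hti : t.1 = i
    · subst hti
      exact absurd (h₂.2 he.1) he.2
    · have hti' : i ≠ t.1 := fun h => hti h.symm
      refine absurd (h.eq_of_exiting hexit hi ⟨?_, ?_⟩) hti
      · rw [← loc_execute_of_ne ht hti']
        exact he.1
      · rw [← h₁ i hti']
        exact he.2

theorem BarrierConsistent.nodeInv {s : P.State} (hs : P.BarrierConsistent s) :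
    NodeInv (P.initNode s) := by
  refine ⟨hs.blockedAtBarrier, fun i _ he => ?_⟩
  rcases hs with h | h
  · exact absurd ((h i).2 he.1) he.2
  · exact fun j => ⟨h.2 j, by simp [initNode, h.1]⟩

theorem Reachable.nodeInv (hexit : ∀ i : T, (∀ j, i ≤ j) → Disjoint (P.BarrierStates i) (R i))
    {u v : P.Node} (hu : NodeInv u) (h : P.Reachable R u v) : NodeInv v := by
  induction h with
  | refl => exact hu
  | tail _ h ih => obtain ⟨t, h⟩ := h; exact ih.edge hexit h

/-- The statements recorded for a thread are kept, except by the barrier exit of the least thread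
and by the steps of that thread from states in `R`. -/
theorem mem_nextHist {s : P.State} {a : (i : T) → Set (P.ThreadStmt i)} {t : P.Stmt}
    (ht : ¬ (t.2 = .exit ∧ ∀ j, t.1 ≤ j)) {x : P.Stmt}
    (hx : t.1 ≠ x.1 ∨ s.loc t.1 ∉ R t.1 ∨ P.IsNsyncStmt t) (h : x.2 ∈ a x.1) :
    x.2 ∈ P.nextHist R s a t x.1 := by
  unfold nextHist
  rw [if_neg ht]
  split_ifs with h₁ h₂
  · by_cases hxt : x.1 = t.1
    · obtain ⟨i, x⟩ := x
      obtain ⟨j, t⟩ := t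
      simp only at hxt
      subst hxt
      simp only at h ⊢
      rw [Function.update_self]
      exact Set.mem_insert_of_mem _ h
    · rwa [Function.update_of_ne hxt]
  · rcases hx with hx | hx | hx
    · rwa [Function.update_of_ne hx.symm]
    · exact absurd h₂ hx
    · exact absurd hx h₁
  · exact h

theorem mem_nextHist_self {s : P.State} {a : (i : T) → Set (P.ThreadStmt i)} {t : P.Stmt}
    (ht : P.IsNsyncStmt t) : t.2 ∈ P.nextHist R s a t t.1 := by
  simp [nextHist, ht]

theorem not_exit_of_isNsyncStmt {t : P.Stmt} (ht : P.IsNsyncStmt t) : t.2 ≠ .exit := by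
  obtain ⟨x, hx⟩ := isNsyncStmt_iff.1 ht
  simp [hx]

variable (R) in
/-- A step of a normal thread. -/
def NormalEdge (u v : P.Node) : Prop := ∃ t, P.Edge R u t v ∧ P.Normal R u.state t.1

theorem localEdge_execute {s : P.State} {t : P.Stmt} (ht : t ∈ P.enabled s) :
    P.LocalEdge t.1 (s.loc t.1) ((P.execute s t).loc t.1) := by
  unfold LocalEdge
  rcases enabled_cases ht with ⟨_, _, o, _, _, q⟩ | ⟨_, _, o, _, _, q⟩ |
    ⟨_, o, _, _, q⟩ | ⟨_, _, _, x, o, hx, _, q⟩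
  · simp [o, q, moveTo]
  · simp [o, q, moveTo]
  · simp [o, q, moveTo]
  · simp only [o, q, moveTo, Function.update_self]
    exact ⟨x, hx, _, _, rfl⟩

theorem exists_path_of_transGen {α : Type*} {r : α → α → Prop} {a b : α}
    (h : Relation.TransGen r a b) :
    ∃ (n : ℕ) (c : ℕ → α), 0 < n ∧ c 0 = a ∧ c n = b ∧ ∀ k < n, r (c k) (c (k + 1)) := by
  induction h using Relation.TransGen.head_induction_on with
  | @single a h => exact ⟨1, fun k => if k = 0 then a else b, by simp [h]⟩
  | @head a c h _ ih =>
    obtain ⟨n, d, hn, h₀, h₁, h₂⟩ := ih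
    refine ⟨n + 1, fun k => Nat.casesOn k a d, by simp, rfl, h₁, fun k hk => ?_⟩
    cases k with
    | zero => simpa [h₀] using h
    | succ k => exact h₂ k (by omega)

/-- A closed path of normal steps moves some thread; projected to that thread it is a closed path of
its local graph whose edges all start outside `R`. -/
theorem not_transGen_normalEdge (hR : P.IsReductionSets R) (u : P.Node) :
    ¬ Relation.TransGen (NormalEdge R) u u := by
  let r : (i : T) → P.Local i → P.Local i → Prop := fun i σ σ' => P.LocalEdge i σ σ' ∧ σ ∉ R i
  have key : ∀ u v : P.Node, NormalEdge R u v →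
      (∃ i, Relation.TransGen (r i) (u.state.loc i) (v.state.loc i)) ∧
      ∀ i, Relation.ReflTransGen (r i) (u.state.loc i) (v.state.loc i) := by
    rintro u v ⟨t, h, hn⟩
    have h₁ : Relation.TransGen (r t.1) (u.state.loc t.1) (v.state.loc t.1) := by
      rw [h.1.2]
      exact .single ⟨localEdge_execute h.1.1, hn.1⟩
    refine ⟨⟨t.1, h₁⟩, fun i => ?_⟩
    by_cases hi : i = t.1
    · subst hi; exact h₁.to_reflTransGen
    · rw [h.1.2, loc_execute_of_ne h.1.1 hi]
  have key' : ∀ u v : P.Node, Relation.TransGen (NormalEdge R) u v →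
      (∃ i, Relation.TransGen (r i) (u.state.loc i) (v.state.loc i)) ∧
      ∀ i, Relation.ReflTransGen (r i) (u.state.loc i) (v.state.loc i) := by
    intro u v h
    induction h with
    | single h => exact key _ _ h
    | tail _ h ih =>
      obtain ⟨⟨i, hi⟩, ih⟩ := ih
      have := (key _ _ h).2
      exact ⟨⟨i, hi.trans_left (this i)⟩, fun i => (ih i).trans (this i)⟩
  intro h
  obtain ⟨⟨i, hi⟩, _⟩ := key' _ _ h
  obtain ⟨n, c, hn, h₀, h₁, h₂⟩ := exists_path_of_transGen hi
  obtain ⟨k, hk, hk'⟩ := hR.cycle i n c hn (h₁.trans h₀.symm) fun k hk => (h₂ k hk).1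
  exact (h₂ k hk).2 hk'

/-- Running normal threads terminates. -/
theorem acc_normalEdge (hR : P.IsReductionSets R) {u₀ : P.Node}
    (hfin : {v : P.Node | P.Reachable R u₀ v}.Finite) {u : P.Node} (hu : P.Reachable R u₀ u) :
    Acc (fun v u => NormalEdge R u v) u := by
  have : Finite {v : P.Node | P.Reachable R u₀ v} := hfin
  let r : {v : P.Node | P.Reachable R u₀ v} → {v : P.Node | P.Reachable R u₀ v} → Prop :=
    fun a b => Relation.TransGen (NormalEdge R) b.1 a.1
  have : IsTrans _ r := ⟨fun _ _ _ h h' => h'.trans h⟩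
  have : Std.Irrefl r := ⟨fun a => not_transGen_normalEdge hR a.1⟩
  have wf : WellFounded r := Finite.wellFounded_of_trans_of_irrefl r
  suffices ∀ a : {v : P.Node | P.Reachable R u₀ v}, Acc (fun v u => NormalEdge R u v) a.1 from
    this ⟨u, hu⟩
  intro a
  induction a using wf.induction with
  | _ a ih =>
    refine ⟨_, fun v hv => ih ⟨v, ?_⟩ (.single hv)⟩
    obtain ⟨t, ht, _⟩ := hv
    exact Relation.ReflTransGen.tail a.2 ⟨t, ht⟩

end NormalSteps

/-! ### From coenabled conflicting statements to a detecting edge. -/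

section Detection

variable {T : Type uT} [LinearOrder T] [Fintype T] {P : Program.{uT, uK, uS, uL, uN} T}
  {conflict : P.Stmt → P.Stmt → Prop} {R : (i : T) → Set (P.Local i)}

/-- If a thread moves to a barrier while another thread can execute an nsync statement, then it
is blocked. -/
theorem mem_blocked_execute {f : P.State} (hf : BlockedAtBarrier f) {t y : P.Stmt}
    (ht : t ∈ P.enabled f) (hy : y ∈ P.enabled f) (hty : t.1 ≠ y.1) {i : T}
    (hi : i ≠ t.1 → f.loc i ∈ P.BarrierStates i → i ∈ f.blocked)
    (h : (P.execute f t).loc i ∈ P.BarrierStates i) : i ∈ (P.execute f t).blocked := by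
  rcases execute_blocked hf ht with ⟨h', _⟩ | ⟨h₁, h₂⟩
  · exact absurd (h' y.1 hty.symm) (notMem_blocked_of_enabled hf hy)
  · by_cases hit : i = t.1
    · subst hit; exact h₂.2 h
    · rw [loc_execute_of_ne ht hit] at h
      exact (h₁ i hit).2 (hi hit h)

/-- This is what allows the first step of a normal thread in a run to be pulled to the front. For a
barrier exit, normality at `s` already means that the thread is not blocked there. -/
theorem Normal.enabled_of_run (hR : P.IsReductionSets R) {s g : P.State} {t : P.Stmt}
    (hn : P.Normal R s t.1) {l : List P.Stmt} (h : Run s l g) (hl : ∀ x ∈ l, x.1 ≠ t.1)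
    (ht : t ∈ P.enabled g) : t ∈ P.enabled s ∧ Persistent t := by
  have hloc := h.loc_eq hl
  have hp : Persistent t := Normal.persistent hR
    (normal_of_enabled ht (hloc ▸ hn.1)) ht
  refine ⟨?_, hp⟩
  rcases hp with hp | hp
  · exact (h.enabled_nsync_iff hp hl).1 ht
  · rw [enabled_exit_iff hp] at ht ⊢
    obtain ⟨n, hn'⟩ := hloc ▸ ht.1
    obtain ⟨z, hz⟩ := hn.2
    exact ⟨⟨n, hn'⟩, ((enabled_barrier (t := ⟨t.1, z⟩) hn').1 hz).2⟩

theorem normal_of_notMem (hR : P.IsReductionSets R) {s : P.State} {i : T}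
    (h : s.loc i ∉ R i ∪ P.BarrierStates i ∪ P.TermStates i) : P.Normal R s i := by
  simp only [Set.mem_union, not_or] at h
  obtain ⟨⟨h₁, h₂⟩, h₃⟩ := h
  refine ⟨h₁, ?_⟩
  rcases ho : P.op i (s.loc i) with ⟨l, n⟩ | ⟨l, n⟩ | n | ⟨st, ⟨x, hx⟩, up⟩ | _
  · exact absurd (hR.acquire_subset _ ⟨l, n, ho⟩) h₁
  · exact absurd (hR.release_subset _ ⟨l, n, ho⟩) h₁
  · exact absurd ⟨n, ho⟩ h₂
  · exact ⟨.nsync x, (enabled_nsync (t := ⟨i, .nsync x⟩) ho).2 ⟨x, hx, rfl⟩⟩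
  · exact absurd ho h₃

theorem DetectsRaceFrom.intro (hc : P.IsConflictRelation conflict) {u₀ u v : P.Node}
    (hu : P.Reachable R u₀ u) {t x y : P.Stmt} (h : P.Edge R u t v) (hty : t.1 = y.1)
    (hxy : conflict x y) (hx : x.2 ∈ v.hist x.1) (hy : y.2 ∈ v.hist y.1)
    (hv : v.state.loc y.1 ∈ R y.1 ∪ P.BarrierStates y.1 ∪ P.TermStates y.1) :
    P.DetectsRaceFrom R conflict u₀ := by
  refine ⟨u, t, v, hu, h, ?_⟩
  have : P.tid t = y.1 := hty
  rw [EdgeDetects, this]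
  exact ⟨hv, x.1, (hc.nsync _ _ hxy).2.2, y.2, hy, x.2, hx, hc.symm _ _ hxy⟩

variable {u₀ : P.Node}

/-- The thread of `y` stays normal until it arrives at a state where races are checked, so the least
normal thread can be run until this happens, which it does by termination. These steps keep the
records: they start outside `R`, and none is the exit of the least thread, which would require all
threads to be at barriers. -/
theorem detectsRaceFrom_of_hist (hc : P.IsConflictRelation conflict)
    (hR : P.IsReductionSets R)
    (hexit : ∀ i : T, (∀ j, i ≤ j) → Disjoint (P.BarrierStates i) (R i))
    (h₀ : NodeInv u₀) (hfin : {v : P.Node | P.Reachable R u₀ v}.Finite)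
    {u : P.Node} (hu : P.Reachable R u₀ u) {x y : P.Stmt} (hxy : conflict x y)
    (hx : x.2 ∈ u.hist x.1) (hy : y.2 ∈ u.hist y.1)
    (hl : u.state.loc y.1 ∉ R y.1 ∪ P.BarrierStates y.1 ∪ P.TermStates y.1) :
    P.DetectsRaceFrom R conflict u₀ := by
  have hacc := acc_normalEdge hR hfin hu
  induction hacc with
  | intro u _ ih =>
    obtain ⟨i, hi⟩ := exists_isLeast_normal ⟨_, normal_of_notMem hR hl⟩
    obtain ⟨t, ht, rfl⟩ := Normal.exists_enabled hi.1
    have he : P.Edge R u t (stepNode R u t) := edge_stepNode ht fun _ => hi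
    have hne : ¬ (t.2 = .exit ∧ ∀ j, t.1 ≤ j) := fun ⟨h₁, h₂⟩ =>
      hl (.inl (.inr ((hu.nodeInv hexit h₀).2 _ h₂ ((enabled_exit_iff h₁).1 ht) y.1).1))
    have hx' : x.2 ∈ (stepNode R u t).hist x.1 := mem_nextHist hne (.inr (.inl hi.1.1)) hx
    have hy' : y.2 ∈ (stepNode R u t).hist y.1 := mem_nextHist hne (.inr (.inl hi.1.1)) hy
    by_cases hm : (stepNode R u t).state.loc y.1 ∈
        R y.1 ∪ P.BarrierStates y.1 ∪ P.TermStates y.1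
    · by_cases hty : t.1 = y.1
      · exact .intro hc hu he hty hxy hx' hy' hm
      · exact absurd (loc_execute_of_ne ht (Ne.symm hty) ▸ hm) hl
    · exact ih _ ⟨t, he, hi.1⟩ (hu.tail ⟨t, he⟩) hx' hy' hm

theorem detectsRaceFrom_of_edge (hc : P.IsConflictRelation conflict)
    (hR : P.IsReductionSets R)
    (hexit : ∀ i : T, (∀ j, i ≤ j) → Disjoint (P.BarrierStates i) (R i))
    (h₀ : NodeInv u₀) (hfin : {v : P.Node | P.Reachable R u₀ v}.Finite)
    {u v : P.Node} (hu : P.Reachable R u₀ u) {x y : P.Stmt} (h : P.Edge R u y v)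
    (hxy : conflict x y) (hx : x.2 ∈ v.hist x.1) :
    P.DetectsRaceFrom R conflict u₀ := by
  have hy : y.2 ∈ v.hist y.1 := by
    rw [h.eq_stepNode]
    exact mem_nextHist_self (hc.nsync _ _ hxy).2.1
  by_cases hm : v.state.loc y.1 ∈ R y.1 ∪ P.BarrierStates y.1 ∪ P.TermStates y.1
  · exact .intro hc hu h rfl hxy hx hy hm
  · exact detectsRaceFrom_of_hist hc hR hexit h₀ hfin (hu.tail ⟨y, h⟩) hxy hx hy hm

/-- In the first clause both conflicting statements are still ahead; in the second, `x` is already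
recorded. The outer induction is on the length of the run, which drops when a step of the run is
taken as an edge or when a conflict cuts the run short. The inner induction, on accessibility for
normal edges, covers inserted steps, which keep the length. The last hypothesis of the second clause
protects the record of `x` from the exit of the least thread. -/
theorem detectsRaceFrom_aux (hc : P.IsConflictRelation conflict)
    (hR : P.IsReductionSets R)
    (hexit : ∀ i : T, (∀ j, i ≤ j) → Disjoint (P.BarrierStates i) (R i))
    (h₀ : NodeInv u₀) (hfin : {v : P.Node | P.Reachable R u₀ v}.Finite) (n : ℕ) :
    (∀ u, P.Reachable R u₀ u → ∀ l f x y, l.length = n → Run u.state l f →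
      x ∈ P.enabled f → y ∈ P.enabled f → conflict x y → P.DetectsRaceFrom R conflict u₀) ∧
    (∀ u, P.Reachable R u₀ u → ∀ l f x y, l.length = n → Run u.state l f →
      (∀ t ∈ l, t.1 ≠ x.1) → x.2 ∈ u.hist x.1 → y ∈ P.enabled f → conflict x y →
      (f.loc x.1 ∈ P.BarrierStates x.1 → x.1 ∈ f.blocked) →
      P.DetectsRaceFrom R conflict u₀) := by
  induction n using Nat.strong_induction_on with
  | _ n ih =>
  have second : ∀ u, P.Reachable R u₀ u → ∀ l f x y, l.length = n → Run u.state l f →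
      (∀ t ∈ l, t.1 ≠ x.1) → x.2 ∈ u.hist x.1 → y ∈ P.enabled f → conflict x y →
      (f.loc x.1 ∈ P.BarrierStates x.1 → x.1 ∈ f.blocked) →
      P.DetectsRaceFrom R conflict u₀ := by
    intro u hu
    have hacc := acc_normalEdge hR hfin hu
    induction hacc with
    | intro u _ ihu =>
    intro l f x y hn hrun hlx hx hy hxy hset
    have hinv := hu.nodeInv hexit h₀
    have hne : x.1 ≠ y.1 := (hc.nsync _ _ hxy).2.2
    -- If the least thread could exit at `u`, so could the thread of `x`. But that thread does not
    -- move in `l`, so being blocked at `f` it is blocked at `u`.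
    have keep : ∀ t ∈ P.enabled u.state, (t.1 ≠ x.1 ∨ u.state.loc t.1 ∉ R t.1) →
        x.2 ∈ (stepNode R u t).hist x.1 := by
      intro t ht htx
      refine mem_nextHist (fun ⟨h₁, h₂⟩ => ?_) (htx.imp_right .inl) hx
      have he := hinv.2 _ h₂ ((enabled_exit_iff h₁).1 ht) x.1
      exact he.2 (hrun.mem_blocked hlx (hset (hrun.loc_eq hlx ▸ he.1)))
    by_cases hnor : ∃ i, P.Normal R u.state i
    · obtain ⟨i, hi⟩ := exists_isLeast_normal hnor
      rcases exists_first (fun t : P.Stmt => t.1 = i) l with hli | ⟨l₁, t, l₂, rfl, rfl, hl₁⟩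
      -- The inserted statement is arbitrary, except that `y` itself is chosen if its thread is the
      -- one to be scheduled.
      · obtain ⟨t, ht, rfl, hty⟩ : ∃ t ∈ P.enabled u.state, t.1 = i ∧ (i = y.1 → t = y) := by
          by_cases hiy : i = y.1
          · subst hiy
            exact ⟨y, (hrun.enabled_nsync_iff (hc.nsync _ _ hxy).2.1 hli).1 hy, rfl, fun _ => rfl⟩
          · obtain ⟨t, ht, hti⟩ := Normal.exists_enabled hi.1
            exact ⟨t, ht, hti, fun h => absurd h hiy⟩
        have he : P.Edge R u t (stepNode R u t) := edge_stepNode ht fun _ => hi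
        have hp := Normal.persistent hR hi.1 ht
        have hx' := keep t ht (.inr hi.1.1)
        rcases hrun.commute_or_conflict hc hinv.1 hp ht hli with
          ⟨l', g, z, hl', hg, hz, ht', hzt⟩ | hcom
        · exact (ih _ (hn ▸ hl')).1 u hu l' g z t rfl hg hz ht' hzt
        · by_cases hty' : t.1 = y.1
          · obtain rfl := hty hty'
            exact detectsRaceFrom_of_edge hc hR hexit h₀ hfin hu he hxy hx'
          · have htf := hp.enabled_run hrun hli ht
            exact ihu _ ⟨t, he, hi.1⟩ (hu.tail ⟨t, he⟩) l _ x y hn hcom hlx hx'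
              (Persistent.enabled_execute (.inl (hc.nsync _ _ hxy).2.1) hy htf hty') hxy
              (mem_blocked_execute (hrun.blockedAtBarrier hinv.1) htf hy hty' fun _ => hset)
      · obtain ⟨g, hg, htg, hgf⟩ := run_append.1 hrun
        obtain ⟨ht, hp⟩ := Normal.enabled_of_run hR hi.1 hg hl₁ htg
        have he : P.Edge R u t (stepNode R u t) := edge_stepNode ht fun _ => hi
        rcases hg.commute_or_conflict hc hinv.1 hp ht hl₁ with
          ⟨l', g', z, hl', hg', hz, ht', hzt⟩ | hcom
        · exact (ih _ (by rw [← hn, List.length_append]; omega)).1 u hu l' g' z t rfl hg' hz ht' hzt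
        · exact (ih _ (by rw [← hn, List.length_append, List.length_append]; simp)).2
            (stepNode R u t) (hu.tail ⟨t, he⟩) (l₁ ++ l₂) f x y rfl
            (run_append.2 ⟨_, hcom, hgf⟩) (fun z hz => hlx z (by
              rcases List.mem_append.1 hz with h | h <;> simp [h]))
            (keep t ht (.inl (hlx t (by simp)))) hy hxy hset
    · cases l with
      | nil =>
        obtain rfl : u.state = f := hrun
        exact detectsRaceFrom_of_edge hc hR hexit h₀ hfin hu
          (edge_stepNode hy fun h => absurd h hnor) hxy (keep y hy (.inl hne.symm))
      | cons t l =>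
        exact (ih _ (by rw [← hn]; simp)).2 (stepNode R u t)
          (hu.tail ⟨t, edge_stepNode hrun.1 fun h => absurd h hnor⟩) l f x y rfl hrun.2
          (fun z hz => hlx z (List.mem_cons_of_mem _ hz))
          (keep t hrun.1 (.inl (hlx t List.mem_cons_self))) hy hxy hset
  refine ⟨?_, second⟩
  intro u hu
  have hacc := acc_normalEdge hR hfin hu
  induction hacc with
  | intro u _ ihu =>
  intro l f x y hn hrun hx hy hxy
  have hinv := hu.nodeInv hexit h₀
  have front : ∀ x y, x ∈ P.enabled f → y ∈ P.enabled f → conflict x y →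
      (∀ t ∈ l, t.1 ≠ x.1) →
      ((∃ i, P.Normal R u.state i) → IsLeast {i | P.Normal R u.state i} x.1) →
      P.DetectsRaceFrom R conflict u₀ := by
    intro x y hx hy hxy hlx hle
    have hsx := (hc.nsync _ _ hxy).1
    have hux := (hrun.enabled_nsync_iff hsx hlx).1 hx
    have hne : x.1 ≠ y.1 := (hc.nsync _ _ hxy).2.2
    rcases hrun.commute_or_conflict hc hinv.1 (.inl hsx) hux hlx with
      ⟨l', g, z, hl', hg, hz, ht', hzt⟩ | hcom
    · exact (ih _ (hn ▸ hl')).1 u hu l' g z x rfl hg hz ht' hzt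
    · exact second (stepNode R u x) (hu.tail ⟨x, edge_stepNode hux hle⟩) l _ x y hn hcom hlx
        (mem_nextHist_self hsx)
        (Persistent.enabled_execute (.inl (hc.nsync _ _ hxy).2.1) hy hx hne) hxy
        (mem_blocked_execute (hrun.blockedAtBarrier hinv.1) hx hy hne fun h => absurd rfl h)
  by_cases hnor : ∃ i, P.Normal R u.state i
  · obtain ⟨i, hi⟩ := exists_isLeast_normal hnor
    rcases exists_first (fun t : P.Stmt => t.1 = i) l with hli | ⟨l₁, t, l₂, rfl, rfl, hl₁⟩
    · by_cases hix : i = x.1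
      · subst hix
        exact front x y hx hy hxy hli fun _ => hi
      by_cases hiy : i = y.1
      · subst hiy
        exact front y x hy hx (hc.symm _ _ hxy) hli fun _ => hi
      obtain ⟨t, ht, rfl⟩ := Normal.exists_enabled hi.1
      have he : P.Edge R u t (stepNode R u t) := edge_stepNode ht fun _ => hi
      have hp := Normal.persistent hR hi.1 ht
      rcases hrun.commute_or_conflict hc hinv.1 hp ht hli with
        ⟨l', g, z, hl', hg, hz, ht', hzt⟩ | hcom
      · exact (ih _ (hn ▸ hl')).1 u hu l' g z t rfl hg hz ht' hzt
      · have htf := hp.enabled_run hrun hli ht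
        exact ihu _ ⟨t, he, hi.1⟩ (hu.tail ⟨t, he⟩) l _ x y hn hcom
          (Persistent.enabled_execute (.inl (hc.nsync _ _ hxy).1) hx htf hix)
          (Persistent.enabled_execute (.inl (hc.nsync _ _ hxy).2.1) hy htf hiy) hxy
    · obtain ⟨g, hg, htg, hgf⟩ := run_append.1 hrun
      obtain ⟨ht, hp⟩ := Normal.enabled_of_run hR hi.1 hg hl₁ htg
      have he : P.Edge R u t (stepNode R u t) := edge_stepNode ht fun _ => hi
      rcases hg.commute_or_conflict hc hinv.1 hp ht hl₁ with
        ⟨l', g', z, hl', hg', hz, ht', hzt⟩ | hcom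
      · exact (ih _ (by rw [← hn, List.length_append]; omega)).1 u hu l' g' z t rfl hg' hz ht' hzt
      · exact (ih _ (by rw [← hn, List.length_append, List.length_append]; simp)).1
          (stepNode R u t) (hu.tail ⟨t, he⟩) (l₁ ++ l₂) f x y rfl
          (run_append.2 ⟨_, hcom, hgf⟩) hx hy hxy
  · cases l with
    | nil => exact front x y hx hy hxy (by simp) fun h => absurd h hnor
    | cons t l =>
      exact (ih _ (by rw [← hn]; simp)).1 (stepNode R u t)
        (hu.tail ⟨t, edge_stepNode hrun.1 fun h => absurd h hnor⟩) l f x y rfl hrun.2 hx hy hxy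

/-- A race is detected if two conflicting statements are enabled at a state that the program can
reach from a reachable node. -/
theorem detectsRaceFrom_of_coenabled (hc : P.IsConflictRelation conflict)
    (hR : P.IsReductionSets R)
    (hexit : ∀ i : T, (∀ j, i ≤ j) → Disjoint (P.BarrierStates i) (R i))
    (h₀ : NodeInv u₀) (hfin : {v : P.Node | P.Reachable R u₀ v}.Finite)
    {l : List P.Stmt} {f : P.State} (h : Run u₀.state l f) {x y : P.Stmt}
    (hx : x ∈ P.enabled f) (hy : y ∈ P.enabled f) (hxy : conflict x y) :
    P.DetectsRaceFrom R conflict u₀ :=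
  (detectsRaceFrom_aux hc hR hexit h₀ hfin l.length).1 u₀ .refl l f x y rfl h hx hy hxy

end Detection

/-! ### Epochs, and reordering a run with a race. -/

section Epochs

open scoped Classical

variable {T : Type uT} [LinearOrder T] [Fintype T] {P : Program.{uT, uK, uS, uL, uN} T}

/-- The numbers of barrier exits of the threads after execution of `t`. -/
noncomputable def bump (E : T → ℕ) (t : P.Stmt) : T → ℕ :=
  Function.update E t.1 (E t.1 + if t.2 = .exit then 1 else 0)

theorem bump_of_ne {E : T → ℕ} {t : P.Stmt} {j : T} (h : j ≠ t.1) : bump E t j = E j := by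
  simp [bump, h]

theorem bump_self {E : T → ℕ} {t : P.Stmt} :
    bump E t t.1 = E t.1 + if t.2 = .exit then 1 else 0 := by
  simp [bump]

theorem bump_comm {E : T → ℕ} {t t' : P.Stmt} (h : t.1 ≠ t'.1) :
    bump (bump E t) t' = bump (bump E t') t := by
  unfold bump
  rw [Function.update_of_ne h.symm, Function.update_of_ne h, Function.update_comm h]

theorem bump_of_not_exit {E : T → ℕ} {t : P.Stmt} (h : t.2 ≠ .exit) : bump E t = E := by
  simp [bump, h]

theorem le_bump (E : T → ℕ) (t : P.Stmt) (j : T) : E j ≤ bump E t j := by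
  by_cases h : j = t.1
  · subst h; simp [bump_self]
  · rw [bump_of_ne h]

/-- `c` barriers have been completed before `s` is reached: a thread has exited all of them, or
is about to exit the last one. -/
def Phase (c : ℕ) (s : P.State) (E : T → ℕ) : Prop :=
  ∀ i, (E i + 1 = c ∧ Exiting s i) ∨ (E i = c ∧ (i ∈ s.blocked ↔ s.loc i ∈ P.BarrierStates i))

theorem BarrierConsistent.exists_phase {s : P.State} (hs : P.BarrierConsistent s) :
    ∃ c, Phase c s fun _ => 0 := by
  rcases hs with h | h
  · exact ⟨0, fun i => .inr ⟨rfl, h i⟩⟩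
  · exact ⟨1, fun i => .inl ⟨rfl, h.2 i, by simp [h.1]⟩⟩

theorem Phase.blockedAtBarrier {c : ℕ} {s : P.State} {E : T → ℕ} (h : Phase c s E) :
    BlockedAtBarrier s := by
  intro i hi
  rcases h i with h | h
  · exact absurd hi h.2.2
  · exact h.2.1 hi

theorem Phase.le {c : ℕ} {s : P.State} {E : T → ℕ} (h : Phase c s E) (i : T) : E i ≤ c := by
  rcases h i with h | h <;> omega

theorem Phase.eq_of_not_exiting {c : ℕ} {s : P.State} {E : T → ℕ} (h : Phase c s E) {i : T}
    (hi : ¬ Exiting s i) : E i = c := by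
  rcases h i with h | h
  · exact absurd h.2 hi
  · exact h.1

theorem Phase.eq_of_exiting {c : ℕ} {s : P.State} {E : T → ℕ} (h : Phase c s E) {i : T}
    (hi : Exiting s i) : E i + 1 = c := by
  rcases h i with h | h
  · exact h.1
  · exact absurd (h.2.2 hi.1) hi.2

theorem exit_of_exiting {s : P.State} {t : P.Stmt} (ht : t ∈ P.enabled s)
    (h : s.loc t.1 ∈ P.BarrierStates t.1) : t.2 = .exit := by
  obtain ⟨n, hn⟩ := h
  exact ((enabled_barrier hn).1 ht).1

/-- Thus the epoch of an event is the number of barriers completed before it, whatever its thread;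
in particular, epochs never decrease along a run. -/
theorem Phase.bump_eq {c : ℕ} {s : P.State} {E : T → ℕ} (h : Phase c s E) {t : P.Stmt}
    (ht : t ∈ P.enabled s) : bump E t t.1 = c := by
  rw [bump_self]
  by_cases hx : t.2 = .exit
  · simpa [hx] using h.eq_of_exiting ((enabled_exit_iff hx).1 ht)
  · simpa [hx] using h.eq_of_not_exiting fun he => hx (exit_of_exiting ht he.1)

theorem Phase.execute {c : ℕ} {s : P.State} {E : T → ℕ} (h : Phase c s E) {t : P.Stmt}
    (ht : t ∈ P.enabled s) : ∃ c', c ≤ c' ∧ Phase c' (P.execute s t) (bump E t) := by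
  have hc := h.bump_eq ht
  rcases execute_blocked h.blockedAtBarrier ht with ⟨h₁, h₂⟩ | ⟨h₁, h₂⟩
  · refine ⟨c + 1, by omega, fun j => .inl ⟨?_, h₂ j⟩⟩
    by_cases hj : j = t.1
    · subst hj; omega
    · rw [bump_of_ne hj, h.eq_of_not_exiting fun he => he.2 (h₁ j hj)]
  · refine ⟨c, le_rfl, fun j => ?_⟩
    by_cases hj : j = t.1
    · subst hj; exact .inr ⟨hc, h₂⟩
    · rw [bump_of_ne hj, Exiting, loc_execute_of_ne ht hj, h₁ j hj]
      exact h j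

/-- The events of a list are consistent with the epochs `ep`, if the list starts at exit
counts `E`. -/
def EpochsOK (ep : P.Event → ℕ) : (T → ℕ) → List P.Event → Prop
  | _, [] => True
  | E, e :: l => ep e = bump E e.1 e.1.1 ∧ EpochsOK ep (bump E e.1) l

variable {ep : P.Event → ℕ} {conflict : P.Stmt → P.Stmt → Prop}

theorem EpochsOK.of_append {E : T → ℕ} {l l' : List P.Event} (h : EpochsOK ep E (l ++ l')) :
    EpochsOK ep E l := by
  induction l generalizing E with
  | nil => trivial
  | cons x l ih => exact ⟨h.1, ih h.2⟩

/-- Exits are counted per thread, so only the order within each thread matters. -/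
theorem EpochsOK.move_front {E : T → ℕ} {l₁ l₂ : List P.Event} {y : P.Event}
    (h : EpochsOK ep E (l₁ ++ y :: l₂)) (hl : ∀ x ∈ l₁, x.1.1 ≠ y.1.1) :
    EpochsOK ep E (y :: (l₁ ++ l₂)) := by
  induction l₁ generalizing E with
  | nil => exact h
  | cons x l₁ ih =>
    have hxy := hl x List.mem_cons_self
    obtain ⟨h₁, h₂, h₃⟩ : ep x = _ ∧ ep y = _ ∧ _ :=
      ⟨h.1, ih h.2 fun z hz => hl z (List.mem_cons_of_mem _ hz)⟩
    refine ⟨?_, ?_, ?_⟩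
    · rw [h₂, bump_self, bump_self, bump_of_ne hxy.symm]
    · rw [h₁, bump_self, bump_self, bump_of_ne hxy]
    · rwa [bump_comm hxy.symm]

theorem Phase.le_epoch {l : List P.Event} {c : ℕ} {s f : P.State} {E : T → ℕ}
    (h : Phase c s E) (hr : Run s (l.map Prod.fst) f) (he : EpochsOK ep E l) :
    ∀ e ∈ l, c ≤ ep e := by
  induction l generalizing c s E with
  | nil => simp
  | cons x l ih =>
    intro e hx
    rcases List.mem_cons.1 hx with rfl | hx
    · rw [he.1, h.bump_eq hr.1]
    · obtain ⟨c', hc', h'⟩ := h.execute hr.1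
      exact hc'.trans (ih h' hr.2 he.2 e hx)

/-- A release of a lock and an acquire of the same lock. -/
def IsReleaseAcquire (x y : P.Stmt) : Prop := ∃ l, P.IsReleaseStmt l x ∧ P.IsAcquireStmt l y

theorem isReleaseAcquire_of_eq {x y : P.Stmt} {l : P.Lock} (hx : x.2 = .release l)
    (hy : y.2 = .acquire l) : IsReleaseAcquire x y :=
  ⟨l, ⟨x.1, Sigma.ext rfl (heq_of_eq hx)⟩, ⟨y.1, Sigma.ext rfl (heq_of_eq hy)⟩⟩

theorem execute_lock {s : P.State} {t : P.Stmt} (ht : t ∈ P.enabled s) (l : P.Lock) :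
    (t.2 = .acquire l ∧ s.lock l = none ∧ (P.execute s t).lock l = some t.1) ∨
    (t.2 = .release l ∧ s.lock l = some t.1 ∧ (P.execute s t).lock l = none) ∨
    (P.execute s t).lock l = s.lock l := by
  rcases enabled_cases ht with ⟨l', _, _, h, h', q⟩ | ⟨l', _, _, h, h', q⟩ |
    ⟨_, _, _, _, q⟩ | ⟨_, _, _, _, _, _, _, q⟩
  · by_cases hl : l = l'
    · subst hl; exact .inl ⟨h, h', by simp [q, moveTo]⟩
    · exact .inr (.inr (by simp [q, moveTo, hl]))
  · by_cases hl : l = l'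
    · subst hl; exact .inr (.inl ⟨h, h', by simp [q, moveTo]⟩)
    · exact .inr (.inr (by simp [q, moveTo, hl]))
  · exact .inr (.inr (by simp [q, moveTo]))
  · exact .inr (.inr (by simp [q, moveTo]))

/-- A step of another thread can enable a statement only by releasing a lock or by completing a
barrier; the last two hypotheses exclude these. -/
theorem enabled_of_enabled_execute {s : P.State} {x y : P.Stmt} (hx : x ∈ P.enabled s)
    (hy : y ∈ P.enabled (P.execute s x)) (hxy : x.1 ≠ y.1) (hra : ¬ IsReleaseAcquire x y)
    (hexit : y.2 = .exit → y.1 ∉ s.blocked) : y ∈ P.enabled s := by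
  have hl := loc_execute_of_ne hx hxy.symm
  rcases enabled_cases hy with ⟨l, _, o, h, h', _⟩ | ⟨l, _, o, h, h', _⟩ |
    ⟨_, _, h, _⟩ | ⟨_, _, _, z, _, _, h, _⟩
  · rw [hl] at o
    refine (enabled_acquire o).2 ⟨h, ?_⟩
    rcases execute_lock hx l with q | q | q
    · exact q.2.1
    · exact absurd (isReleaseAcquire_of_eq q.1 h) hra
    · rw [← q, h']
  · rw [hl] at o
    refine (enabled_release o).2 ⟨h, ?_⟩
    rcases execute_lock hx l with q | q | q
    · rw [q.2.2] at h'
      exact absurd (Option.some.inj h') hxy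
    · rw [q.2.2] at h'
      exact absurd h' (by simp)
    · rw [← q, h']
  · rw [enabled_exit_iff h] at hy ⊢
    exact ⟨hl ▸ hy.1, hexit h⟩
  · exact (IsNsyncStmt.enabled_congr (isNsyncStmt_iff.2 ⟨z, h⟩) hl).1 hy

/-- An event can be moved to the front of a run, past events that it does not depend on. -/
theorem Phase.move_front (hc : P.IsConflictRelation conflict) {l : List P.Event} {y : P.Event}
    {c : ℕ} {s f : P.State} {E : T → ℕ} (h : Phase c s E)
    (hr : Run s ((l ++ [y]).map Prod.fst) f) (he : EpochsOK ep E (l ++ [y]))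
    (hl : ∀ x ∈ l, x.1.1 ≠ y.1.1 ∧ ¬ conflict x.1 y.1 ∧ ¬ IsReleaseAcquire x.1 y.1 ∧
      ¬ ep x < ep y) :
    y.1 ∈ P.enabled s ∧ Run (P.execute s y.1) (l.map Prod.fst) f := by
  induction l generalizing c s E with
  | nil => exact hr
  | cons x l ih =>
    obtain ⟨hx, hr⟩ : x.1 ∈ P.enabled s ∧ Run _ ((l ++ [y]).map Prod.fst) f := hr
    obtain ⟨c', hcc', h'⟩ := h.execute hx
    obtain ⟨h₁, h₂, h₃, h₄⟩ := hl x List.mem_cons_self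
    have hl' := fun z hz => hl z (List.mem_cons_of_mem _ hz)
    obtain ⟨hy, hr'⟩ := ih h' hr he.2 hl'
    -- If `y` is an exit of a thread blocked at `s`, its epoch is `c + 1` while that of `x` is `c`,
    -- against the assumption on epochs.
    have hys : y.1 ∈ P.enabled s := by
      refine enabled_of_enabled_execute hx hy h₁ h₃ fun hexit hb => h₄ ?_
      have e₁ : ep x = _ := he.1
      have e₂ := (EpochsOK.move_front (l₂ := []) he.2 fun z hz => (hl' z hz).1).1
      rw [e₁, h.bump_eq hx, e₂, bump_self, bump_of_ne h₁.symm,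
        h.eq_of_not_exiting fun hex => hex.2 hb]
      simp [hexit]
    obtain ⟨h₅, h₆⟩ := execute_swap hc h.blockedAtBarrier h₁ hx hys hy h₂
    exact ⟨hys, h₅, h₆ ▸ hr'⟩

variable {HB : P.Event → P.Event → Prop}

/-- The order of two events `x`, `y` of a race-free execution, `x` first, is compatible with
`HB`. -/
def Ordered (conflict : P.Stmt → P.Stmt → Prop) (ep : P.Event → ℕ)
    (HB : P.Event → P.Event → Prop) (x y : P.Event) : Prop :=
  ¬ HB y x ∧ (x.1.1 = y.1.1 → HB x y) ∧ (IsReleaseAcquire x.1 y.1 → HB x y) ∧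
    (ep x < ep y → HB x y) ∧ (conflict x.1 y.1 → HB x y)

/-- If the last event `q` of a run races with an event `p`, and there are no other races, then
the run can be reordered so that it reaches a state at which both statements are enabled. -/
theorem exists_coenabled (hc : P.IsConflictRelation conflict)
    (htrans : ∀ x y z, HB x y → HB y z → HB x z) (hirr : ∀ x, ¬ HB x x) {p q : P.Event}
    (hpq : conflict p.1 q.1) (hnpq : ¬ HB p q) (n : ℕ) :
    ∀ (l : List P.Event) (c : ℕ) (s f : P.State) (E : T → ℕ), l.length = n → Phase c s E →
      Run s ((l ++ [q]).map Prod.fst) f → EpochsOK ep E (l ++ [q]) →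
      l.Pairwise (Ordered conflict ep HB) → p ∈ l → (∀ x ∈ l, x.1.1 = q.1.1 → HB x q) →
      ∃ m g, Run s m g ∧ p.1 ∈ P.enabled g ∧ q.1 ∈ P.enabled g := by
  induction n with
  | zero =>
    intro l c s f E hn _ _ _ _ hp
    simp [List.length_eq_zero_iff.1 hn] at hp
  | succ n ih =>
    intro l c s f E hn h hr he ho hp hlq
    -- If no predecessor of `p` or `q` is left, neither thread moves before its racing statement,
    -- and both statements are enabled already. Otherwise the first such predecessor `y` depends on
    -- nothing in front of it, by transitivity, and can be executed at once.
    rcases exists_first (fun x => HB x p ∨ HB x q) l with hK | ⟨l₁, y, l₂, rfl, hy, hK⟩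
    · obtain ⟨l₁, l₂, rfl⟩ := List.append_of_mem hp
      obtain ⟨hsp, hsq, _⟩ := hc.nsync _ _ hpq
      have ho' := (List.pairwise_append.1 ho).2.2
      simp only [List.map_append, List.append_assoc] at hr
      rw [← List.append_assoc] at hr
      obtain ⟨g, hg, hgf⟩ := run_append.1 hr
      have hg' := hg
      obtain ⟨g', hg₁, hg₂⟩ := run_append.1 hg
      refine ⟨[], s, rfl, ?_, ?_⟩
      · refine (hg₁.enabled_nsync_iff hsp ?_).1 hg₂.1
        intro t ht htp
        obtain ⟨x, hx, rfl⟩ := List.mem_map.1 ht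
        exact hK x (List.mem_append_left _ hx) (.inl ((ho' x hx p List.mem_cons_self).2.1 htp))
      · refine (hg'.enabled_nsync_iff hsq ?_).1 hgf.1
        intro t ht htq
        rw [← List.map_append] at ht
        obtain ⟨x, hx, rfl⟩ := List.mem_map.1 ht
        exact hK x hx (.inr (hlq x hx htq))
    · have ho' := (List.pairwise_append.1 ho).2.2
      have hind : ∀ x ∈ l₁, x.1.1 ≠ y.1.1 ∧ ¬ conflict x.1 y.1 ∧
          ¬ IsReleaseAcquire x.1 y.1 ∧ ¬ ep x < ep y := by
        intro x hx
        have hxy : ¬ HB x y := fun hxy => hK x hx (hy.imp (htrans _ _ _ hxy) (htrans _ _ _ hxy))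
        obtain ⟨_, h₁, h₂, h₃, h₄⟩ := ho' x hx y List.mem_cons_self
        exact ⟨fun h => hxy (h₁ h), fun h => hxy (h₄ h), fun h => hxy (h₂ h),
          fun h => hxy (h₃ h)⟩
      have hyp : p ≠ y := by
        rintro rfl
        exact hy.elim (hirr _) hnpq
      have hr' : Run s ((l₁ ++ [y]).map Prod.fst ++ (l₂ ++ [q]).map Prod.fst) f := by
        simpa using hr
      obtain ⟨g, hg, hgf⟩ := run_append.1 hr'
      have he' := EpochsOK.move_front (l₂ := l₂ ++ [q]) (by simpa using he)
        fun x hx => (hind x hx).1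
      have he₁ : EpochsOK ep E (l₁ ++ [y]) :=
        EpochsOK.of_append (l' := l₂ ++ [q]) (by simpa using he)
      obtain ⟨hys, hgy⟩ := h.move_front hc hg he₁ hind
      obtain ⟨c', _, h'⟩ := h.execute hys
      have hsub : ∀ x ∈ l₁ ++ l₂, x ∈ l₁ ++ y :: l₂ := fun x hx => by
        rcases List.mem_append.1 hx with h | h <;> simp [h]
      obtain ⟨m, g', hm, hm'⟩ := ih (l₁ ++ l₂) c' (P.execute s y.1) f (bump E y.1)
        (by simp at hn ⊢; omega) h'
        (by
          have := run_append.2 ⟨g, hgy, hgf⟩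
          simpa using this) (by simpa using he'.2)
        (ho.sublist ((List.sublist_cons_self y l₂).append_left l₁))
        (by
          rcases List.mem_append.1 hp with h | h
          · exact List.mem_append_left _ h
          · exact List.mem_append_right _ ((List.mem_cons.1 h).resolve_left hyp))
        (fun x hx => hlq x (hsub x hx))
      exact ⟨y.1 :: m, g', ⟨hys, hm⟩, hm'⟩

end Epochs

/-! ### Replaying a race-free run in the graph. -/

section Replay

variable {T : Type uT} [LinearOrder T] [Fintype T] {P : Program.{uT, uK, uS, uL, uN} T}
  {conflict : P.Stmt → P.Stmt → Prop} {R : (i : T) → Set (P.Local i)} {ep : P.Event → ℕ}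

theorem mem_of_transGen {α : Type*} {D : α → α → Prop} {l : List α}
    (hup : ∀ x ∈ l, ∀ z, D x z → z ∈ l) {x z : α} (h : Relation.TransGen D x z) (hx : x ∈ l) :
    z ∈ l := by
  induction h with
  | single h => exact hup _ hx _ h
  | tail _ h ih => exact hup _ ih _ h

/-- A race-free run to a final state can be replayed in the graph. Here `D` generates the
happens-before relation, and `l` is the list of the events that are not executed yet. -/
theorem reachable_of_raceFree (hc : P.IsConflictRelation conflict) (hR : P.IsReductionSets R)
    {D : P.Event → P.Event → Prop}
    (hD : ∀ x y, D x y → x.1.1 = y.1.1 ∨ IsReleaseAcquire x.1 y.1 ∨ ep x < ep y)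
    (hirr : ∀ x, ¬ Relation.TransGen D x x) {f : P.State} (hf : P.enabled f = ∅)
    {u₀ : P.Node} (n : ℕ) :
    ∀ (l : List P.Event) (u : P.Node) (c : ℕ) (E : T → ℕ), l.length = n →
      P.Reachable R u₀ u → Phase c u.state E → Run u.state (l.map Prod.fst) f →
      EpochsOK ep E l → l.Pairwise (Ordered conflict ep (Relation.TransGen D)) →
      (∀ x ∈ l, ∀ z, D x z → z ∈ l) → ∃ v, P.Reachable R u₀ v ∧ v.state = f := by
  induction n with
  | zero =>
    intro l u c E hn hu _ hr
    rw [List.length_eq_zero_iff.1 hn] at hr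
    exact fun _ _ _ => ⟨u, hu, hr⟩
  | succ n ih =>
    intro l u c E hn hu h hr he ho hup
    by_cases hnor : ∃ i, P.Normal R u.state i
    · obtain ⟨i, hi⟩ := exists_isLeast_normal hnor
      rcases exists_first (fun x : P.Event => x.1.1 = i) l with hl | ⟨l₁, y, l₂, rfl, rfl, hl₁⟩
      · obtain ⟨t, ht, rfl⟩ := Normal.exists_enabled hi.1
        -- The statement of a thread that does not move in the rest of the run would stay enabled at
        -- `f`.
        have := (Normal.persistent hR hi.1 ht).enabled_run hr (fun t' ht' => by
          obtain ⟨x, hx, rfl⟩ := List.mem_map.1 ht'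
          exact hl x hx) ht
        simp [hf] at this
      · have hr' : Run u.state (l₁.map Prod.fst ++ y.1 :: l₂.map Prod.fst) f := by simpa using hr
        obtain ⟨g, hg, hyg, hgf⟩ := run_append.1 hr'
        have hl₁' : ∀ t ∈ l₁.map Prod.fst, t.1 ≠ y.1.1 := fun t ht => by
          obtain ⟨x, hx, rfl⟩ := List.mem_map.1 ht
          exact hl₁ x hx
        obtain ⟨hy, hp⟩ := Normal.enabled_of_run hR hi.1 hg hl₁' hyg
        have he' := he.move_front hl₁
        obtain ⟨ho₁, ho₂, ho₃⟩ := List.pairwise_append.1 ho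
        -- Among the remaining events, `y` is the first of its thread, is not an acquire, and has
        -- the least possible epoch.
        have hD' : ∀ z ∈ l₁ ++ y :: l₂, ¬ D z y := by
          intro z hz hzy
          rcases hD z y hzy with hzy' | ⟨k, _, j, hj⟩ | hzy'
          · rcases List.mem_append.1 hz with hz | hz
            · exact hl₁ z hz hzy'
            · rcases List.mem_cons.1 hz with rfl | hz
              · exact hirr _ (.single hzy)
              · exact ((List.pairwise_cons.1 ho₂).1 z hz).1 (.single hzy)
          · rcases hp with hp | hp
            · obtain ⟨x, hx⟩ := isNsyncStmt_iff.1 (hj ▸ hp)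
              cases hx
            · rw [hj] at hp
              cases hp
          · rw [show ep y = _ from he'.1, h.bump_eq hy] at hzy'
            exact absurd hzy' (h.le_epoch hr he z hz).not_gt
        -- A conflict would force a `D`-chain ending in `y`. The chain stays inside the remaining
        -- events, which are closed under `D`-successors, so its last link contradicts `hD'`.
        have hnc : ∀ t ∈ l₁.map Prod.fst, ¬ conflict t y.1 := by
          intro t ht hty
          obtain ⟨x, hx, rfl⟩ := List.mem_map.1 ht
          have hxy := (ho₃ x hx y List.mem_cons_self).2.2.2.2 hty
          obtain ⟨z, hxz, hzy⟩ := Relation.TransGen.tail'_iff.1 hxy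
          refine hD' z ?_ hzy
          rcases Relation.reflTransGen_iff_eq_or_transGen.1 hxz with rfl | hxz
          · exact List.mem_append_left _ hx
          · exact mem_of_transGen hup hxz (List.mem_append_left _ hx)
        have hcom := hg.commute hc h.blockedAtBarrier hp hy hl₁' hnc
        obtain ⟨c', _, h'⟩ := h.execute hy
        refine ih (l₁ ++ l₂) (stepNode R u y.1) c' (bump E y.1) (by simp at hn ⊢; omega)
          (hu.tail ⟨y.1, edge_stepNode hy fun _ => hi⟩) h' ?_ he'.2
          (ho.sublist ((List.sublist_cons_self y l₂).append_left l₁)) ?_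
        · rw [List.map_append]
          exact run_append.2 ⟨_, hcom, hgf⟩
        · intro x hx z hxz
          have hx' : x ∈ l₁ ++ y :: l₂ := by
            rcases List.mem_append.1 hx with h | h <;> simp [h]
          have hzy : z ≠ y := by
            rintro rfl
            exact hD' x hx' hxz
          rcases List.mem_append.1 (hup x hx' z hxz) with h | h
          · exact List.mem_append_left _ h
          · exact List.mem_append_right _ ((List.mem_cons.1 h).resolve_left hzy)
    · cases l with
      | nil => simp at hn
      | cons y l =>
        obtain ⟨hy, hr⟩ : y.1 ∈ P.enabled u.state ∧ Run _ (l.map Prod.fst) f := hr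
        obtain ⟨c', _, h'⟩ := h.execute hy
        obtain ⟨ho₁, ho₂⟩ := List.pairwise_cons.1 ho
        refine ih l (stepNode R u y.1) c' (bump E y.1) (by simpa using hn)
          (hu.tail ⟨y.1, edge_stepNode hy fun h => absurd h hnor⟩) h' hr he.2 ho₂ ?_
        intro x hx z hxz
        refine (List.mem_cons.1 (hup x (List.mem_cons_of_mem _ hx) z hxz)).resolve_left ?_
        rintro rfl
        exact (ho₁ x hx).1 (.single hxz)

end Replay

/-! ### Trace positions, epochs and happens-before of an execution. -/

namespace Execution

open scoped Classical

variable {T : Type uT} [LinearOrder T] [Fintype T] {P : Program.{uT, uK, uS, uL, uN} T}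
  {α : P.Execution}

theorem EventAt.eq {k : ℕ} {e e' : P.Event} (h : α.EventAt k e) (h' : α.EventAt k e') :
    e = e' := by
  have h₁ : e.1 = e'.1 := Option.some.inj (h.1.symm.trans h'.1)
  refine Prod.ext h₁ ?_
  rw [h.2, h'.2, h₁]

theorem exists_eventAt {k : ℕ} {t : P.Stmt} (h : α.label k = some t) :
    ∃ e, α.EventAt k e ∧ e.1 = t :=
  ⟨(t, ((Finset.range (k + 1)).filter
    fun j => ∃ t', α.label j = some t' ∧ P.tid t' = P.tid t).card), ⟨h, rfl⟩, rfl⟩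

theorem EventAt.lt_of_lt {k k' : ℕ} {e e' : P.Event} (h : α.EventAt k e)
    (h' : α.EventAt k' e') (ht : P.tid e.1 = P.tid e'.1) (hk : k < k') : e.2 < e'.2 := by
  rw [h.2, h'.2, ht]
  refine Finset.card_lt_card (Finset.ssubset_iff_of_subset ?_ |>.2 ⟨k', ?_, ?_⟩)
  · exact Finset.filter_subset_filter _ (Finset.range_subset_range.2 (by omega))
  · exact Finset.mem_filter.2 ⟨by simp, _, h'.1, rfl⟩
  · simp; omega

theorem EventAt.unique {k k' : ℕ} {e : P.Event} (h : α.EventAt k e) (h' : α.EventAt k' e) :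
    k = k' := by
  rcases lt_trichotomy k k' with hk | hk | hk
  · exact absurd (h.lt_of_lt h' rfl hk) (lt_irrefl _)
  · exact hk
  · exact absurd (h'.lt_of_lt h rfl hk) (lt_irrefl _)

theorem EventAt.lt_iff {k k' : ℕ} {e e' : P.Event} (h : α.EventAt k e)
    (h' : α.EventAt k' e') (ht : P.tid e.1 = P.tid e'.1) : e.2 < e'.2 ↔ k < k' := by
  refine ⟨fun he => ?_, h.lt_of_lt h' ht⟩
  rcases lt_trichotomy k k' with hk | hk | hk
  · exact hk
  · subst hk
    rw [h.eq h'] at he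
    exact absurd he (lt_irrefl _)
  · exact absurd (h'.lt_of_lt h ht.symm hk) he.not_gt

theorem EventAt.intraThread {k k' : ℕ} {e e' : P.Event} (h : α.EventAt k e)
    (h' : α.EventAt k' e') (ht : P.tid e.1 = P.tid e'.1) (hk : k < k') : α.IntraThread e e' :=
  ⟨⟨k, h⟩, ⟨k', h'⟩, ht, h.lt_of_lt h' ht hk⟩

variable (α) in
/-- The number of barrier exits of thread `i` before position `k`. -/
noncomputable def exits (k : ℕ) (i : T) : ℕ :=
  ((Finset.range k).filter fun j => α.label j = some ⟨i, .exit⟩).card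

theorem exits_zero : α.exits 0 = fun _ => 0 := by
  funext i; simp [exits]

theorem exits_succ {k : ℕ} {t : P.Stmt} (h : α.label k = some t) :
    α.exits (k + 1) = bump (α.exits k) t := by
  funext i
  by_cases hi : i = t.1
  · subst hi
    rw [bump_self, exits, exits, Finset.range_add_one, Finset.filter_insert]
    by_cases ht : t.2 = .exit
    · have : α.label k = some ⟨t.1, .exit⟩ := by rw [h, ← ht]
      rw [if_pos this, if_pos ht, Finset.card_insert_of_notMem (by simp)]
    · have : ¬ α.label k = some ⟨t.1, .exit⟩ := fun h' => by
        rw [h] at h'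
        exact ht (by rw [Option.some.inj h'])
      rw [if_neg this, if_neg ht, add_zero]
  · rw [bump_of_ne hi, exits, exits, Finset.range_add_one, Finset.filter_insert, if_neg]
    intro h'
    rw [h] at h'
    exact hi (by rw [Option.some.inj h'])

theorem exits_mono {k k' : ℕ} (h : k ≤ k') (i : T) : α.exits k i ≤ α.exits k' i :=
  Finset.card_le_card (Finset.filter_subset_filter _ (Finset.range_subset_range.2 h))

/-- Within one thread, event numbers and trace positions are ordered alike, so counting exit events
by number amounts to counting their positions up to and including `k`. -/
theorem EventAt.epoch_eq {k : ℕ} {e : P.Event} (h : α.EventAt k e) :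
    α.epoch e = α.exits (k + 1) (P.tid e.1) := by
  set i := P.tid e.1 with hi
  let num : ℕ → ℕ := fun k => ((Finset.range (k + 1)).filter
      (fun j => ∃ t, α.label j = some t ∧ P.tid t = i)).card
  have hnum : ∀ j, α.label j = some ⟨i, .exit⟩ →
      α.EventAt j ((⟨i, .exit⟩ : P.Stmt), num j) := fun j hj => ⟨hj, rfl⟩
  have hset : {e' : P.Event | e' ∈ α.events ∧
      ∃ j, 1 ≤ j ∧ j ≤ e.2 ∧ e' = (⟨P.tid e.1, .exit⟩, j)} =
      (fun j => (((⟨i, .exit⟩ : P.Stmt), num j) : P.Event)) ''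
        ((Finset.range (k + 1)).filter fun j => α.label j = some ⟨i, .exit⟩ : Finset ℕ) := by
    ext e'
    constructor
    · rintro ⟨⟨k', hk'⟩, j, _, hj, rfl⟩
      have hl : α.label k' = some ⟨i, .exit⟩ := hk'.1
      refine ⟨k', ?_, (hnum k' hl).eq hk'⟩
      rw [Finset.mem_coe, Finset.mem_filter, Finset.mem_range]
      refine ⟨?_, hl⟩
      by_contra hlt
      have := h.lt_of_lt hk' rfl (by omega)
      exact absurd hj this.not_ge
    · rintro ⟨k', hk', rfl⟩
      rw [Finset.mem_coe, Finset.mem_filter, Finset.mem_range] at hk'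
      have hev := hnum k' hk'.2
      refine ⟨⟨k', hev⟩, num k', ?_, ?_, rfl⟩
      · exact Finset.card_pos.2 ⟨k', Finset.mem_filter.2 ⟨by simp, _, hk'.2, rfl⟩⟩
      · rcases Nat.lt_or_ge k' k with hlt | hge
        · exact (hev.lt_of_lt h rfl hlt).le
        · obtain rfl : k' = k := by omega
          exact (congrArg Prod.snd (hev.eq h)).le
  rw [epoch, hset, Set.InjOn.ncard_image, Set.ncard_coe_finset, exits]
  intro j hj j' hj' hjj
  simp only [Finset.coe_filter, Set.mem_ofPred_eq] at hj hj'
  have h₁ := hnum j hj.2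
  have h₂ := hnum j' hj'.2
  simp only at hjj
  rw [hjj] at h₁
  exact h₁.unique h₂

theorem label_isSome_of_le {k k' : ℕ} (h : k ≤ k') {t : P.Stmt} (ht : α.label k' = some t) :
    ∃ t', α.label k = some t' := by
  rw [← Option.ne_none_iff_exists']
  intro hn
  have h₁ := (α.label_eq_none_iff k).1 hn
  have h₂ := (α.label_eq_none_iff k').2 (h₁.trans (by exact_mod_cast h))
  simp [ht] at h₂

theorem exists_phase_of_le {k m c : ℕ} (h : Phase c (α.state k) (α.exits k)) (hkm : k ≤ m)
    (hm : ∀ j < m, ∃ t, α.label j = some t) :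
    ∃ c', c ≤ c' ∧ Phase c' (α.state m) (α.exits m) := by
  induction m, hkm using Nat.le_induction with
  | base => exact ⟨c, le_rfl, h⟩
  | succ m hkm ih =>
    obtain ⟨c', hc', h'⟩ := ih fun j hj => hm j (by omega)
    obtain ⟨t, ht⟩ := hm m (by omega)
    obtain ⟨hen, hst⟩ := α.transition m t ht
    obtain ⟨c'', hc'', h''⟩ := h'.execute hen
    rw [hst, exits_succ ht]
    exact ⟨c'', hc'.trans hc'', h''⟩

variable (hs : P.BarrierConsistent (α.state 0))

include hs

theorem EventAt.lt_of_epoch_lt {k k' : ℕ} {e e' : P.Event} (h : α.EventAt k e)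
    (h' : α.EventAt k' e') (he : α.epoch e < α.epoch e') : k < k' := by
  by_contra hk
  push Not at hk
  obtain ⟨c₀, h₀⟩ := hs.exists_phase
  rw [← exits_zero (α := α)] at h₀
  have hlab : ∀ j < k, ∃ t, α.label j = some t := fun j hj => label_isSome_of_le hj.le h.1
  obtain ⟨c, _, hc⟩ := exists_phase_of_le h₀ (Nat.zero_le k') fun j hj => hlab j (by omega)
  obtain ⟨c', hcc', hc'⟩ := exists_phase_of_le hc hk hlab
  rw [h.epoch_eq, h'.epoch_eq, exits_succ h.1, exits_succ h'.1, tid, tid,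
    hc.bump_eq (α.transition k' _ h'.1).1, hc'.bump_eq (α.transition k _ h.1).1] at he
  omega

/-- Each of the three generating relations respects the order of the trace; for barriers this is the
monotonicity of epochs. Irreflexivity of happens-before follows. -/
theorem HB.exists_lt {e e' : P.Event} (h : α.HB e e') :
    ∃ k k', α.EventAt k e ∧ α.EventAt k' e' ∧ k < k' := by
  have key : ∀ e e' : P.Event, (α.IntraThread e e' ∨ α.ReleaseAcquire e e' ∨ α.BarrierRel e e') →
      ∃ k k', α.EventAt k e ∧ α.EventAt k' e' ∧ k < k' := by
    rintro e e' (⟨⟨k, h⟩, ⟨k', h'⟩, ht, hlt⟩ | ⟨_, k, k', hlt, h, h', _⟩ | ⟨⟨k, h⟩, ⟨k', h'⟩, hlt⟩)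
    · exact ⟨k, k', h, h', (h.lt_iff h' ht).1 hlt⟩
    · exact ⟨k, k', h, h', hlt⟩
    · exact ⟨k, k', h, h', h.lt_of_epoch_lt hs h' hlt⟩
  induction h with
  | single h => exact key _ _ h
  | tail _ h ih =>
    obtain ⟨k, k', hk, hk', hlt⟩ := ih
    obtain ⟨m, m', hm, hm', hlt'⟩ := key _ _ h
    obtain rfl := hm.unique hk'
    exact ⟨k, m', hk, hm', hlt.trans hlt'⟩

theorem EventAt.lt_of_hb {k k' : ℕ} {e e' : P.Event} (h : α.EventAt k e)
    (h' : α.EventAt k' e') (he : α.HB e e') : k < k' := by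
  obtain ⟨m, m', hm, hm', hlt⟩ := HB.exists_lt hs he
  rwa [h.unique hm, h'.unique hm']

omit hs

theorem exists_release {l : P.Lock} {i : T} {k m : ℕ} (hkm : k ≤ m)
    (hm : ∀ j < m, ∃ t, α.label j = some t) (hk : (α.state k).lock l = some i)
    (hml : (α.state m).lock l ≠ some i) :
    ∃ r, k ≤ r ∧ r < m ∧ α.label r = some ⟨i, .release l⟩ := by
  induction m, hkm using Nat.le_induction with
  | base => exact absurd hk hml
  | succ m hkm ih =>
    by_cases hl : (α.state m).lock l = some i
    · obtain ⟨t, ht⟩ := hm m (by omega)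
      obtain ⟨hen, hst⟩ := α.transition m t ht
      refine ⟨m, hkm, by omega, ?_⟩
      rcases execute_lock hen l with q | q | q
      · rw [hl] at q
        exact absurd q.2.1 (by simp)
      · have hti : t.1 = i := by
          have := q.2.1
          rw [hl] at this
          exact (Option.some.inj this).symm
        subst hti
        rw [ht, ← q.1]
      · rw [hst, q] at hml
        exact absurd hl hml
    · obtain ⟨r, h₁, h₂, h₃⟩ := ih (fun j hj => hm j (by omega)) hl
      exact ⟨r, h₁, by omega, h₃⟩

/-- A release happens before every later acquire of the same lock. -/
theorem EventAt.hb_of_isReleaseAcquire {k k' : ℕ} {e e' : P.Event} (h : α.EventAt k e)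
    (h' : α.EventAt k' e') (hk : k < k') (hra : IsReleaseAcquire e.1 e'.1) : α.HB e e' := by
  obtain ⟨l, hre, hac⟩ := hra
  induction hn : k' - k using Nat.strong_induction_on generalizing k e with
  | _ n ih =>
  -- The definition orders the release only before the first acquire after it, at `z`. If that is
  -- not the given acquire, the owner must release the lock again before `k'`; the chain goes
  -- through this later release.
  have hex : ∃ j, k < j ∧ ∃ t, α.label j = some t ∧ P.IsAcquireStmt l t := ⟨k', hk, _, h'.1, hac⟩
  obtain ⟨hz₁, t, hz₂, hz₃⟩ := Nat.find_spec hex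
  have hzk : Nat.find hex ≤ k' := Nat.find_min' hex ⟨hk, _, h'.1, hac⟩
  have hmin : ∀ j < Nat.find hex, k < j → ∀ t, α.label j = some t → ¬ P.IsAcquireStmt l t :=
    fun j hj hkj t ht hta => Nat.find_min hex hj ⟨hkj, t, ht, hta⟩
  generalize Nat.find hex = z at hz₁ hz₂ hzk hmin
  obtain ⟨ez, hez, rfl⟩ := exists_eventAt hz₂
  have h₁ : α.HB e ez := .single (.inr (.inl ⟨l, k, z, hz₁, h, hez, hre, hz₃,
    fun j t h₁ h₂ h₃ => hmin j h₂ h₁ t h₃⟩))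
  rcases hzk.eq_or_lt with rfl | hzk
  · rwa [h'.eq hez]
  obtain ⟨i, hi⟩ := hz₃
  obtain ⟨j, hj⟩ := hac
  have hlab : ∀ j < k', ∃ t, α.label j = some t := fun j hj => label_isSome_of_le hj.le h'.1
  obtain ⟨hen, hst⟩ := α.transition z _ hz₂
  have hlock : (α.state (z + 1)).lock l = some i := by
    rw [hst]
    rw [hi] at hen ⊢
    rcases enabled_cases hen with ⟨l', _, _, q, _, q'⟩ | ⟨l', _, _, q, _⟩ | ⟨_, _, q, _⟩ |
      ⟨_, _, _, _, _, _, q, _⟩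
    · cases q
      simp [q', moveTo]
    all_goals cases q
  have hlock' : (α.state k').lock l ≠ some i := by
    have hen' := (α.transition k' _ h'.1).1
    rw [hj] at hen'
    rcases enabled_cases hen' with ⟨l', _, _, q, q', _⟩ | ⟨l', _, _, q, _⟩ | ⟨_, _, q, _⟩ |
      ⟨_, _, _, _, _, _, q, _⟩
    · cases q
      simp [q']
    all_goals cases q
  obtain ⟨r, hr₁, hr₂, hr₃⟩ := exists_release hzk hlab hlock hlock'
  obtain ⟨er, her, her'⟩ := exists_eventAt hr₃
  have h₂ : α.HB ez er := .single (.inl (hez.intraThread her (by rw [hi, her']; rfl) (by omega)))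
  exact h₁.trans (h₂.trans (ih (k' - r) (by omega) her hr₂ ⟨i, her'⟩ rfl))

include hs in
/-- The events of an execution are ordered compatibly with happens-before. -/
theorem EventAt.ordered {conflict : P.Stmt → P.Stmt → Prop} {k k' : ℕ} {e e' : P.Event}
    (h : α.EventAt k e) (h' : α.EventAt k' e') (hk : k < k')
    (hrf : conflict e.1 e'.1 → α.HB e e') : Ordered conflict α.epoch α.HB e e' :=
  ⟨fun hb => absurd (h'.lt_of_hb hs h hb) hk.not_gt,
    fun ht => .single (.inl (h.intraThread h' ht hk)), h.hb_of_isReleaseAcquire h' hk,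
    fun he => .single (.inr (.inr ⟨⟨k, h⟩, ⟨k', h'⟩, he⟩)), hrf⟩

include hs in
theorem not_hb_self (e : P.Event) : ¬ α.HB e e := fun h => by
  obtain ⟨k, k', hk, hk', hlt⟩ := HB.exists_lt hs h
  exact absurd (hk.unique hk') hlt.ne

theorem run_events {ev : ℕ → P.Event} (n m : ℕ) (hev : ∀ k < m + n, α.EventAt k (ev k)) :
    Run (α.state m) (((List.range' m n).map ev).map Prod.fst) (α.state (m + n)) ∧
      EpochsOK α.epoch (α.exits m) ((List.range' m n).map ev) := by
  induction n generalizing m with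
  | zero => exact ⟨rfl, trivial⟩
  | succ n ih =>
    have hm := hev m (by omega)
    obtain ⟨hen, hst⟩ := α.transition m _ hm.1
    obtain ⟨h₁, h₂⟩ := ih (m + 1) fun k hk => hev k (by omega)
    rw [hst] at h₁
    rw [exits_succ hm.1] at h₂
    refine ⟨⟨hen, ?_⟩, ?_, h₂⟩
    · rwa [show m + (n + 1) = m + 1 + n by omega]
    · rw [hm.epoch_eq, exits_succ hm.1]
      rfl

include hs in
theorem pairwise_ordered {conflict : P.Stmt → P.Stmt → Prop} {ev : ℕ → P.Event} {n : ℕ}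
    (hev : ∀ k < n, α.EventAt k (ev k))
    (hrf : ∀ k k', k < k' → k' < n → conflict (ev k).1 (ev k').1 → α.HB (ev k) (ev k')) :
    ((List.range' 0 n).map ev).Pairwise (Ordered conflict α.epoch α.HB) := by
  rw [← List.range_eq_range', List.pairwise_map]
  refine List.pairwise_lt_range.imp_of_mem fun {a b} ha hb hab => ?_
  rw [List.mem_range] at ha hb
  exact (hev a ha).ordered hs (hev b hb) hab (hrf a b hab hb)

end Execution

/-! ### Executions from graph paths, and the two directions for executions. -/

section PathExecution

variable {T : Type uT} [LinearOrder T] [Fintype T] {P : Program.{uT, uK, uS, uL, uN} T}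
  {conflict : P.Stmt → P.Stmt → Prop} {R : (i : T) → Set (P.Local i)}

theorem Run.transition {s f : P.State} {l : List P.Stmt} (h : Run s l f) (k : ℕ) (t : P.Stmt)
    (ht : l[k]? = some t) :
    P.Transition ((l.take k).foldl P.execute s) t ((l.take (k + 1)).foldl P.execute s) := by
  induction l generalizing s k with
  | nil => simp at ht
  | cons x l ih =>
    cases k with
    | zero =>
      obtain rfl : x = t := by simpa using ht
      exact ⟨h.1, rfl⟩
    | succ k => exact ih h.2 k (by simpa using ht)

/-- The execution with the given list of statements. -/
noncomputable def Run.execution {s f : P.State} {l : List P.Stmt} (h : Run s l f) :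
    P.Execution where
  len := l.length
  state k := (l.take k).foldl P.execute s
  label k := l[k]?
  label_eq_none_iff k := by simp
  transition k t ht := h.transition k t ht

theorem Run.exits_execution {s f : P.State} {l : List P.Stmt} (h : Run s l f) (k : ℕ)
    (hk : k ≤ l.length) : h.execution.exits k = (l.take k).foldl bump fun _ => 0 := by
  induction k with
  | zero => simp [Execution.exits_zero]
  | succ k ih =>
    rw [Execution.exits_succ (t := l[k]) (by simp [execution]), ih (by omega),
      List.take_succ_eq_append_getElem (by omega), List.foldl_append]
    rfl

/-- Invariant of a path to the node `u` with labels `l`: the threads with recorded statements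
have exited all barriers, and they have executed only nsync statements since the recorded
statements. -/
structure PathInv (s : P.State) (l : List P.Stmt) (u : P.Node) (E : T → ℕ) : Prop where
  run : Run s l u.state
  foldl_eq : l.foldl bump (fun _ => 0) = E
  phase : ∃ c, Phase c u.state E
  le : ∀ i, (u.hist i).Nonempty → ∀ j, E j ≤ E i
  nsync : ∀ x : P.Stmt, x.2 ∈ u.hist x.1 →
    ∃ k : ℕ, l[k]? = some x ∧ ∀ (k' : ℕ) t, k ≤ k' → l[k']? = some t → t.1 = x.1 → P.IsNsyncStmt t

theorem PathInv.edge (hR : P.IsReductionSets R)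
    (hexit : ∀ i : T, (∀ j, i ≤ j) → Disjoint (P.BarrierStates i) (R i))
    {s : P.State} {l : List P.Stmt} {u v : P.Node} {E : T → ℕ} (h : PathInv s l u E)
    {t : P.Stmt} (he : P.Edge R u t v) : PathInv s (l ++ [t]) v (bump E t) := by
  have ht := he.1.1
  obtain ⟨c, hc⟩ := h.phase
  have hbt := hc.bump_eq ht
  have hle : ∀ j, bump E t j ≤ c := fun j => by
    by_cases hj : j = t.1
    · subst hj; exact hbt.le
    · rw [bump_of_ne hj]; exact hc.le j
  have old : ∀ x : P.Stmt, x.2 ∈ u.hist x.1 → (t.1 = x.1 → P.IsNsyncStmt t) →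
      ∃ k : ℕ, (l ++ [t])[k]? = some x ∧
        ∀ (k' : ℕ) t', k ≤ k' → (l ++ [t])[k']? = some t' → t'.1 = x.1 → P.IsNsyncStmt t' := by
    intro x hx htx
    obtain ⟨k, hk, hk'⟩ := h.nsync x hx
    have hkl := (List.getElem?_eq_some_iff.1 hk).1
    refine ⟨k, by rwa [List.getElem?_append_left hkl], fun k' t' hkk ht' hxt => ?_⟩
    rcases lt_trichotomy k' l.length with hl | hl | hl
    · rw [List.getElem?_append_left hl] at ht'
      exact hk' k' t' hkk ht' hxt
    · subst hl
      obtain rfl : t = t' := by simpa using ht'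
      exact htx hxt
    · rw [List.getElem?_eq_none (by simp; omega)] at ht'
      cases ht'
  -- When another thread exits, the least thread is not able to exit, as it would have priority; so
  -- it has already exited all `c` barriers, and so has every thread with a nonempty record.
  have leastExits : t.2 = .exit → ¬ (∀ j, t.1 ≤ j) → ∀ i, (u.hist i).Nonempty → E i = c := by
    intro hx hnl i hi
    have : Nonempty T := ⟨i⟩
    obtain ⟨i₀, hi₀⟩ : ∃ i₀ : T, ∀ j, i₀ ≤ j := Finite.exists_min id
    have h₀ : ¬ Exiting u.state i₀ := fun h' => hnl (by
      rw [he.eq_of_exiting hexit hi₀ h']; exact hi₀)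
    exact le_antisymm (hc.le i) (hc.eq_of_not_exiting h₀ ▸ h.le i hi i₀)
  have mono : ∀ i, E i = c → ∀ j, bump E t j ≤ bump E t i := fun i hi j =>
    (hle j).trans (hi ▸ le_bump E t i)
  refine ⟨run_append.2 ⟨_, h.run, ht, he.1.2.symm⟩, by rw [List.foldl_append, h.foldl_eq]; rfl,
    ?_, ?_, ?_⟩
  · obtain ⟨c', _, h'⟩ := hc.execute ht
    exact ⟨c', he.1.2 ▸ h'⟩
  · intro i hi
    rw [he.2.1, nextHist] at hi
    split_ifs at hi with h₁ h₂ h₃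
    · have hb := bump_of_not_exit (E := E) (not_exit_of_isNsyncStmt h₁)
      by_cases hit : i = t.1
      · subst hit
        rwa [hbt]
      · rw [Function.update_of_ne hit] at hi
        rw [hb]
        exact h.le i hi
    · simp at hi
    · have hi' : (u.hist i).Nonempty := by
        by_cases hit : i = t.1
        · subst hit; simp at hi
        · rwa [Function.update_of_ne hit] at hi
      by_cases hx : t.2 = .exit
      · exact mono i (leastExits hx (fun h' => h₂ ⟨hx, h'⟩) i hi')
      · rw [bump_of_not_exit hx]
        exact h.le i hi'
    · by_cases hx : t.2 = .exit
      · exact mono i (leastExits hx (fun h' => h₂ ⟨hx, h'⟩) i hi)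
      · rw [bump_of_not_exit hx]
        exact h.le i hi
  · intro x hx
    rw [he.2.1, nextHist] at hx
    split_ifs at hx with h₁ h₂ h₃
    · by_cases hxt : x.1 = t.1
      · by_cases hxt' : x = t
        · subst hxt'
          refine ⟨l.length, by simp, fun k' t' hk' ht' _ => ?_⟩
          rcases hk'.eq_or_lt with rfl | hk'
          · obtain rfl : x = t' := by simpa using ht'
            exact h₁
          · rw [List.getElem?_eq_none (by simp; omega)] at ht'
            cases ht'
        · refine old x ?_ fun _ => h₁
          obtain ⟨i, x⟩ := x
          obtain ⟨j, t⟩ := t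
          simp only at hxt
          subst hxt
          rw [Function.update_self] at hx
          rcases hx with hx | hx
          · simp only at hx
            subst hx
            exact absurd rfl hxt'
          · exact hx
      · rw [Function.update_of_ne hxt] at hx
        exact old x hx fun h => absurd h.symm hxt
    · cases hx
    · by_cases hxt : x.1 = t.1
      · obtain ⟨i, x⟩ := x
        simp only at hxt
        subst hxt
        rw [Function.update_self] at hx
        cases hx
      · rw [Function.update_of_ne hxt] at hx
        exact old x hx fun h => absurd h.symm hxt
    · refine old x hx fun htx => ?_
      rcases Normal.persistent hR (normal_of_enabled ht h₃) ht with hp | hp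
      · exact hp
      -- A thread with a record has no barrier left to exit, so this exit is impossible.
      · have := leastExits hp (fun h' => h₂ ⟨hp, h'⟩) x.1 ⟨_, hx⟩
        have h' := hc.eq_of_exiting ((enabled_exit_iff hp).1 ht)
        rw [htx] at h'
        omega

theorem PathInv.of_reachable (hR : P.IsReductionSets R)
    (hexit : ∀ i : T, (∀ j, i ≤ j) → Disjoint (P.BarrierStates i) (R i))
    {s : P.State} (hs : P.BarrierConsistent s) {u : P.Node}
    (h : P.Reachable R (P.initNode s) u) : ∃ l E, PathInv s l u E := by
  induction h with
  | refl =>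
    exact ⟨[], fun _ => 0, rfl, rfl, hs.exists_phase, fun i hi => absurd hi (by simp [initNode]),
      fun x hx => absurd hx (by simp [initNode])⟩
  | tail _ h ih =>
    obtain ⟨l, E, ih⟩ := ih
    obtain ⟨t, ht⟩ := h
    exact ⟨_, _, ih.edge hR hexit ht⟩

/-- A recorded statement does not happen before events of other threads. -/
theorem PathInv.not_hb {s : P.State} {l : List P.Stmt} {u : P.Node} {E : T → ℕ}
    (h : PathInv s l u E) {x : P.Stmt} (hx : x.2 ∈ u.hist x.1) {k : ℕ}
    (hk : l[k]? = some x)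
    (hns : ∀ (k' : ℕ) t, k ≤ k' → l[k']? = some t → t.1 = x.1 → P.IsNsyncStmt t) {e e' : P.Event}
    (he : h.run.execution.EventAt k e) (hhb : h.run.execution.HB e e') : e'.1.1 = x.1 := by
  set α := h.run.execution with hα
  have hlen : ∀ {k' t}, α.label k' = some t → k' < l.length := fun h' =>
    (List.getElem?_eq_some_iff.1 h').1
  have hE : α.exits l.length = E := by
    rw [h.run.exits_execution _ le_rfl, List.take_length, h.foldl_eq]
  have hconst : ∀ m, k ≤ m → m ≤ l.length → α.exits m x.1 = α.exits k x.1 := by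
    intro m hkm
    induction m, hkm using Nat.le_induction with
    | base => simp
    | succ m hkm ih =>
      intro hm
      have hlab : α.label m = some l[m] := by simp [hα, Run.execution]
      rw [← ih (by omega), Execution.exits_succ hlab]
      by_cases hmx : l[m].1 = x.1
      · rw [bump_of_not_exit (not_exit_of_isNsyncStmt (hns m l[m] hkm hlab hmx))]
      · rw [bump_of_ne (Ne.symm hmx)]
  -- From position `k` on, the thread of `x` has no releases and its epoch is already maximal, so
  -- only the order within the thread leads out of its events.
  have key : ∀ z z' : P.Event, (z.1.1 = x.1 ∧ ∃ m, k ≤ m ∧ α.EventAt m z) →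
      (α.IntraThread z z' ∨ α.ReleaseAcquire z z' ∨ α.BarrierRel z z') →
      (z'.1.1 = x.1 ∧ ∃ m, k ≤ m ∧ α.EventAt m z') := by
    rintro z z' ⟨hz, m, hm, hmz⟩ (⟨_, ⟨m', hm'⟩, ht, hlt⟩ | ⟨lk, m', _, _, hm', _, hre, _⟩ |
      ⟨_, ⟨m', hm'⟩, hlt⟩)
    · exact ⟨ht.symm.trans hz, m', hm.trans ((hmz.lt_iff hm' ht).1 hlt).le, hm'⟩
    · exfalso
      obtain ⟨y, hy⟩ := isNsyncStmt_iff.1 (hns m _ hm hmz.1 hz)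
      obtain ⟨i, hi⟩ := hre
      obtain ⟨⟨j, w⟩, n⟩ := z
      cases hi
      cases hy
    · exfalso
      have hml := hlen hmz.1
      have h₁ : α.epoch z = E x.1 := by
        rw [hmz.epoch_eq, tid, hz, hconst _ (by omega) (by omega), ← hE,
          hconst l.length (by omega) le_rfl]
      have h₂ : α.epoch z' ≤ E x.1 := by
        rw [hm'.epoch_eq]
        refine (Execution.exits_mono (hlen hm'.1) _).trans ?_
        rw [hE]
        exact h.le x.1 ⟨_, hx⟩ _
      omega
  have hex : e.1.1 = x.1 := by
    rw [Option.some.inj (he.1.symm.trans hk)]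
  have : e'.1.1 = x.1 ∧ ∃ m, k ≤ m ∧ α.EventAt m e' := by
    induction hhb with
    | single h => exact key _ _ ⟨hex, k, le_rfl, he⟩ h
    | tail _ h ih => exact key _ _ ih h
  exact this.1

/-- A race detected by the graph occurs in an execution. -/
theorem DetectsRaceFrom.exists_execution (hR : P.IsReductionSets R)
    (hexit : ∀ i : T, (∀ j, i ≤ j) → Disjoint (P.BarrierStates i) (R i))
    {s : P.State} (hs : P.BarrierConsistent s)
    (h : P.DetectsRaceFrom R conflict (P.initNode s)) :
    ∃ α : P.Execution, α.state 0 = s ∧ α.HasDataRace conflict := by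
  obtain ⟨u, t, v, hu, he, _, j, hj, x, hx, y, hy, hxy⟩ := h
  obtain ⟨l, E, hl⟩ := PathInv.of_reachable hR hexit hs (hu.tail ⟨t, he⟩)
  obtain ⟨k, hk, hk'⟩ := hl.nsync ⟨P.tid t, x⟩ hx
  obtain ⟨m, hm, hm'⟩ := hl.nsync ⟨j, y⟩ hy
  obtain ⟨e, he, hex⟩ := Execution.exists_eventAt (α := hl.run.execution) hk
  obtain ⟨e', he', hey⟩ := Execution.exists_eventAt (α := hl.run.execution) hm
  refine ⟨hl.run.execution, rfl, e, e', ⟨k, he⟩, ⟨m, he'⟩, by rwa [hex, hey], fun hb => ?_,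
    fun hb => ?_⟩
  · have := hl.not_hb hx hk hk' he hb
    rw [hey] at this
    exact hj this
  · have := hl.not_hb hy hm hm' he' hb
    rw [hex] at this
    exact hj this.symm

/-- A data race makes two conflicting statements enabled at some reachable state. -/
theorem Execution.HasDataRace.exists_coenabled (hc : P.IsConflictRelation conflict)
    {α : P.Execution} (hs : P.BarrierConsistent (α.state 0)) (h : α.HasDataRace conflict) :
    ∃ l g x y, Run (α.state 0) l g ∧ x ∈ P.enabled g ∧ y ∈ P.enabled g ∧ conflict x y := by
  classical
  -- The least such `m` is used, so that conflicting events before it are ordered. This also reduces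
  -- an infinite execution to a finite prefix.
  have hex : ∃ m k e e', k < m ∧ α.EventAt k e ∧ α.EventAt m e' ∧ conflict e.1 e'.1 ∧
      ¬ α.HB e e' := by
    obtain ⟨e, e', ⟨k, hk⟩, ⟨m, hm⟩, hcf, h₁, h₂⟩ := h
    rcases lt_trichotomy k m with hkm | rfl | hkm
    · exact ⟨m, k, e, e', hkm, hk, hm, hcf, h₁⟩
    · rw [hk.eq hm] at hcf
      exact absurd rfl (hc.nsync _ _ hcf).2.2
    · exact ⟨k, m, e', e, hkm, hm, hk, hc.symm _ _ hcf, h₂⟩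
  obtain ⟨k, p, q, hkm, hp, hq, hcf, hnb⟩ := Nat.find_spec hex
  have hmin := fun j (hj : j < Nat.find hex) => Nat.find_min hex hj
  generalize Nat.find hex = m at *
  have hev : ∀ k, ∃ e, k < m + 1 → α.EventAt k e := fun k => by
    by_cases hk : k < m + 1
    · obtain ⟨t, ht⟩ := label_isSome_of_le (Nat.lt_succ_iff.1 hk) hq.1
      obtain ⟨e, he, _⟩ := exists_eventAt ht
      exact ⟨e, fun _ => he⟩
    · exact ⟨p, fun h => absurd h hk⟩
  choose ev hev using hev
  have hpe : ev k = p := (hev k (by omega)).eq hp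
  have hqe : ev m = q := (hev m (by omega)).eq hq
  obtain ⟨hr, hep⟩ := run_events (m + 1) 0 (ev := ev) (fun k hk => hev k (by omega))
  have hlist : (List.range' 0 (m + 1)).map ev = (List.range' 0 m).map ev ++ [q] := by
    rw [← List.range_eq_range', ← List.range_eq_range', List.range_succ, List.map_append, ← hqe]
    rfl
  rw [hlist] at hr hep
  obtain ⟨c, hph⟩ := hs.exists_phase
  rw [exits_zero] at hep
  have hmem : ∀ x ∈ (List.range' 0 m).map ev, ∃ j < m, α.EventAt j x := fun x hx => by
    rw [← List.range_eq_range'] at hx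
    obtain ⟨j, hj, rfl⟩ := List.mem_map.1 hx
    rw [List.mem_range] at hj
    exact ⟨j, hj, hev j (by omega)⟩
  obtain ⟨l, g, hl, hg₁, hg₂⟩ := Program.exists_coenabled (HB := α.HB) hc
    (fun _ _ _ => Relation.TransGen.trans) (not_hb_self hs) hcf hnb _ _ c _ _ _ rfl hph hr hep
    (pairwise_ordered hs (fun k hk => hev k (by omega)) fun a b hab hb hcab => by
      by_contra hnab
      exact hmin b hb ⟨a, _, _, hab, hev a (by omega), hev b (by omega), hcab, hnab⟩)
    (by
      rw [← List.range_eq_range']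
      exact List.mem_map.2 ⟨k, List.mem_range.2 hkm, hpe⟩)
    (fun x hx htx => by
      obtain ⟨j, hj, hjx⟩ := hmem x hx
      exact .single (.inl (hjx.intraThread hq htx hj)))
  exact ⟨l, g, p.1, q.1, hl, hg₁, hg₂, hcf⟩

/-- The graph reaches the final states of race-free executions. -/
theorem Execution.reachable_final (hc : P.IsConflictRelation conflict)
    (hR : P.IsReductionSets R) {α : P.Execution} (hs : P.BarrierConsistent (α.state 0)) {n : ℕ}
    (hn : α.len = n) (hrf : ¬ α.HasDataRace conflict) (hf : P.enabled (α.state n) = ∅) :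
    ∃ v, P.Reachable R (P.initNode (α.state 0)) v ∧ v.state = α.state n := by
  have hlab : ∀ k, k < n ↔ ∃ t, α.label k = some t := fun k => by
    rw [← Option.ne_none_iff_exists', Ne, α.label_eq_none_iff, hn]
    simp
  -- Positive length provides a statement for the irrelevant values of `ev` beyond the trace.
  rcases Nat.eq_zero_or_pos n with rfl | h0
  · exact ⟨P.initNode (α.state 0), .refl, rfl⟩
  have hev : ∀ k : ℕ, ∃ e : P.Event, k < n → α.EventAt k e := fun k => by
    by_cases hk : k < n
    · obtain ⟨t, ht⟩ := (hlab k).1 hk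
      obtain ⟨e, he, _⟩ := exists_eventAt ht
      exact ⟨e, fun _ => he⟩
    · obtain ⟨t, ht⟩ := (hlab 0).1 h0
      exact ⟨(t, 0), fun h => absurd h hk⟩
  choose ev hev using hev
  obtain ⟨hr, hep⟩ := run_events n 0 (ev := ev) (fun k hk => hev k (by omega))
  obtain ⟨c, hph⟩ := hs.exists_phase
  rw [exits_zero] at hep
  rw [Nat.zero_add] at hr
  refine reachable_of_raceFree (u₀ := P.initNode (α.state 0)) hc hR (ep := α.epoch)
    (D := fun e e' => α.IntraThread e e' ∨ α.ReleaseAcquire e e' ∨ α.BarrierRel e e')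
    ?_ (not_hb_self hs) hf _ _ (P.initNode (α.state 0)) c _ rfl .refl hph hr hep
    (pairwise_ordered hs hev fun a b hab hb hcab => ?_) ?_
  · rintro x y (h | ⟨l, _, _, _, _, _, h₁, h₂, _⟩ | h)
    · exact .inl h.2.2.1
    · exact .inr (.inl ⟨l, h₁, h₂⟩)
    · exact .inr (.inr h.2.2)
  · by_contra hnab
    have ha := hev a (by omega)
    exact hrf ⟨_, _, ⟨a, ha⟩, ⟨b, hev b hb⟩, hcab, hnab, fun hb' =>
      absurd ((hev b hb).lt_of_hb hs ha hb') hab.not_gt⟩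
  · intro x _ z hxz
    obtain ⟨_, j, _, hj, _⟩ := HB.exists_lt hs (.single hxz)
    have hjn := (hlab j).2 ⟨_, hj.1⟩
    rw [← List.range_eq_range']
    exact List.mem_map.2 ⟨j, List.mem_range.2 hjn, (hev j hjn).eq hj⟩

end PathExecution

end Program

theorem theorem1 {T : Type uT} [LinearOrder T] [Fintype T]
    (P : Program.{uT, uK, uS, uL, uN} T)
    (conflict : P.Stmt → P.Stmt → Prop) (hconflict : P.IsConflictRelation conflict)
    (R : (i : T) → Set (P.Local i)) (hR : P.IsReductionSets R)
    (hexit : ∀ i : T, (∀ j, i ≤ j) → Disjoint (P.BarrierStates i) (R i))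
    (s₀ : P.State) (hs₀ : P.BarrierConsistent s₀)
    (hfin : {v : P.Node | P.Reachable R (P.initNode s₀) v}.Finite) :
    ((∃ α : P.Execution, α.state 0 = s₀ ∧ α.HasDataRace conflict) ↔
      P.DetectsRaceFrom R conflict (P.initNode s₀)) ∧
    (∀ s_f : P.State,
      (∃ (α : P.Execution) (n : ℕ), α.state 0 = s₀ ∧ α.len = n ∧ α.state n = s_f ∧
        ¬ α.HasDataRace conflict) →
      P.enabled s_f = ∅ →
      ∃ v : P.Node, P.Reachable R (P.initNode s₀) v ∧ v.state = s_f) := by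
  refine ⟨⟨?_, fun h => h.exists_execution hR hexit hs₀⟩, ?_⟩
  · rintro ⟨α, rfl, h⟩
    obtain ⟨l, g, x, y, hl, hx, hy, hxy⟩ := h.exists_coenabled hconflict hs₀
    exact Program.detectsRaceFrom_of_coenabled hconflict hR hexit hs₀.nodeInv hfin hl hx hy hxy
  · rintro _ ⟨α, n, rfl, hn, rfl, hrf⟩ hf
    exact Program.Execution.reachable_final hconflict hR hs₀ hn hrf hf
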